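/- **Conventions.** For $f\in L^2(\mathbb R^d)$ integrable, $\hat f(\xi)=\int_{\mathbb R^d} f(x)e^{-2\pi i\,\xi\cdot x}\,dx$, and for $D\subseteq\mathbb R^d$, $L^2(D)$ is the space of functions in $L^2(\mathbb R^d)$ supported on $D$. A centered symmetric convex body is a compact convex set $D=-D$ with $0\in\operatorname{int}D$; its polar set is $D^\circ=\{z\in\mathbb R^d: x\cdot z\le 1\ \forall x\in D\}$, and $|x|_{D}=\inf\{a>0: x\in aD\}$. For $\Omega\subseteq\mathbb R^d$ and a centered symmetric convex body $B$, the gap is $\delta_B(\Omega)=\sup_{z\in\mathbb R^d}\inf_{\omega\in\Omega}|\omega-z|_B\in[0,\infty]$ (so $\delta_B(\emptyset)=\infty$ when, as always here, the infimum over the empty set is $+\infty$); $B_1$ is the closed Euclidean unit ball. Given $D$, the Voronoi region of $\omega\in\Omega$ is $V_\omega=\{z\in\mathbb R^d: |\omega-z|_{D^\circ}\le|\lambda-z|_{D^\circ}\ \text{for all }\lambda\in\Omega,\ \lambda\ne\omega\}$, and its weight is $\mu_\omega=\operatorname{meas}(V_\omega)$. For a linear subspace $\mathcal R\subseteq L^2(D)$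 and $K\geq 0$ put $$V(\mathcal R,\Omega,K)=\inf_{f\in\mathcal R,\ \|f\|_2=1}\ \sum_{\omega\in\Omega,\ |\omega|\le K}\mu_\omega|\hat f(\omega)|^2\in[0,\infty].$$ A real number $\alpha$ is a *stability barrier* for the sampling problem associated with $\Omega$ and a sequence of subspaces $\{\mathcal R_N:N\ge1\}$ of $L^2(D)$ if, for all $c>0$ and $\gamma>0$, the bound $\inf_{N\ge1}V(\mathcal R_N,\Omega,cN^\gamma)>0$ implies $\gamma\ge\alpha$. **Corollary 1.6.** Let $D\subseteq\mathbb R^d$ be a centered symmetric convex body and let $\{\mathcal R_N:N\ge1\}$ be a sequence of linear subspaces of $L^2(D)$. Suppose that $\alpha$ is a stability barrier for the sampling problem associated with $\{\mathcal R_N:N\ge1\}$ and a certain closed countable set $\Omega_0\subseteq\mathbb R^d$, where either - $\delta_{D^\circ}(\Omega_0)<1/4$, or - $D=[-1/2,1/2]^d$ and $\Omega_0=\mathbb Z^d$. Then $\alpha$ is a stability barrier for the sampling problem associated with $\{\mathcal R_N:N\ge1\}$ and any closed countable set $\Omega\subseteq\mathbb R^d$ with $\delta_{B_1}(\Omega)<\infty$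 whose Voronoi regions are almost disjoint, i.e. $\operatorname{meas}(V_\omega\cap V_{\omega'})=0$ for all distinct $\omega,\omega'\in\Omega$. -/

import Mathlib

open MeasureTheory
open scoped ENNReal FourierTransform

noncomputable section

namespace FourierSampling

/-- `ℝ^d` with its Euclidean norm, used both for the space variable and for the frequency. -/
abbrev Space (d : ℕ) : Type := EuclideanSpace ℝ (Fin d)

/-- Centered symmetric convex bodies: compact convex sets `D = -D` with `0` in the interior. -/
structure IsCenteredSymmConvexBody {d : ℕ} (D : Set (Space d)) : Prop where
  isCompact : IsCompact D
  convex : Convex ℝ D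
  zero_mem_interior : (0 : Space d) ∈ interior D
  symm : ∀ x ∈ D, -x ∈ D

/-- The polar set `D° = {z | x · z ≤ 1 for all x ∈ D}`. -/
def polarSet {d : ℕ} (D : Set (Space d)) : Set (Space d) :=
  {z | ∀ x ∈ D, inner ℝ x z ≤ 1}

/-- The gap `δ_B(Ω) = sup_z inf_{ω ∈ Ω} |ω - z|_B` with respect to the norm
`|x|_B = inf {a > 0 | x ∈ a B}`, as an extended number: it is `∞` for the empty set. -/
def gap {d : ℕ} (B Ω : Set (Space d)) : ℝ≥0∞ :=
  ⨆ z : Space d, ⨅ ω ∈ Ω, ENNReal.ofReal (gauge B (ω - z))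

/-- The Voronoi region of `ω` in `Ω` with respect to the norm `|·|_B`. -/
def voronoiRegion {d : ℕ} (B Ω : Set (Space d)) (ω : Space d) : Set (Space d) :=
  {z | ∀ ν ∈ Ω, ν ≠ ω → gauge B (ω - z) ≤ gauge B (ν - z)}

/-- The Voronoi weight: the Lebesgue measure of the Voronoi region. -/
def voronoiWeight {d : ℕ} (B Ω : Set (Space d)) (ω : Space d) : ℝ≥0∞ :=
  volume (voronoiRegion B Ω ω)

/-- The Voronoi regions of `Ω` with respect to `|·|_B` overlap only in null sets. -/
def HasAlmostDisjointVoronoi {d : ℕ} (B Ω : Set (Space d)) : Prop :=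
  ∀ ω ∈ Ω, ∀ ν ∈ Ω, ω ≠ ν → volume (voronoiRegion B Ω ω ∩ voronoiRegion B Ω ν) = 0

/-- `R` is a subspace of `L²(D)`, regarded as the functions of `L²(ℝ^d)` supported on `D`. -/
def IsSubspaceOfL2 {d : ℕ} (D : Set (Space d))
    (R : Submodule ℂ (Lp ℂ 2 (volume : Measure (Space d)))) : Prop :=
  ∀ f ∈ R, ∀ᵐ x : Space d, x ∉ D → f x = 0

/-- The concentration measure
`V(R, Ω, K) = inf {∑_{ω ∈ Ω, |ω| ≤ K} μ_ω |f̂(ω)|² : f ∈ R, ‖f‖₂ = 1}`, with the Voronoi weights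
`μ_ω` of `Ω` for the norm of `D°` and `f̂(ω) = ∫ f(x) exp(-2πi ω·x) dx`. Its values are extended
nonnegative numbers, so the infimum over the empty set (`R = 0`) is `∞`. -/
def concentration {d : ℕ} (D : Set (Space d))
    (R : Submodule ℂ (Lp ℂ 2 (volume : Measure (Space d)))) (Ω : Set (Space d)) (K : ℝ) : ℝ≥0∞ :=
  ⨅ f ∈ R, ⨅ _ : ‖f‖ = 1,
    ∑' ω : {ω : Space d // ω ∈ Ω ∧ ‖ω‖ ≤ K},
      voronoiWeight (polarSet D) Ω ω * ‖𝓕 (fun x : Space d => f x) (ω : Space d)‖ₑ ^ 2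

/-- `α` is a stability barrier for the sampling problem associated with `Ω` and
`{R_N : N ≥ 1}`. -/
def IsStabilityBarrier {d : ℕ} (D : Set (Space d))
    (R : ℕ → Submodule ℂ (Lp ℂ 2 (volume : Measure (Space d)))) (Ω : Set (Space d))
    (α : ℝ) : Prop :=
  ∀ c γ : ℝ, 0 < c → 0 < γ →
    0 < (⨅ N : ℕ, ⨅ _ : 1 ≤ N, concentration D (R N) Ω (c * (N : ℝ) ^ γ)) → α ≤ γ

/-- The cube `[-1/2, 1/2]^d`. -/
def unitCube (d : ℕ) : Set (Space d) := {x | ∀ i, x i ∈ Set.Icc (-(1 / 2) : ℝ) (1 / 2)}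

/-- The lattice `ℤ^d`. -/
def integerLattice (d : ℕ) : Set (Space d) := {x | ∀ i, ∃ n : ℤ, x i = (n : ℝ)}

end FourierSampling

end

/-! Two estimates compare samples with the energy of `𝓕 f` on balls, uniformly over unit vectors `f`
of `L²(D)`. Upper estimate (`exists_sampling_le`): the weighted samples of `Ω` in the ball of radius
`K` are at most `C₁` times the energy in the ball of radius `K + M`, plus `η`. Lower estimate
(`exists_lowFrequency_le_of_gap_lt`, `exists_lowFrequency_le_of_unitCube`): for `K ≥ 1` the energy
in the ball of radius `K` is at most `C₂` times the weighted samples of `Ω₀` in the ball of radius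
`L * K`, plus `η`. The constants `C₁`, `C₂` do not depend on `η`, so a positive lower bound for the
samples of `Ω` up to `c * N ^ γ` passes to the energy, and then to the samples of `Ω₀` up to a
larger multiple of the same power `N ^ γ`. The exponent survives, hence so does the barrier.

The upper estimate holds because `f` has compact support: `𝓕 f` equals its convolution with a
Schwartz function, so `‖𝓕 f ω‖²` is at most an average of `‖𝓕 f‖²` against a decaying kernel centred
anywhere in the bounded Voronoi cell of `ω`. Averaging over the almost disjoint cells turns the
weighted sum into an integral.

The lower estimate for gap below `1/4` localizes `𝓕 f` near `ξ` by a factor `𝓕 ψ (ξ - ·)`, where `ψ`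
has tiny support. The product still has spectrum in a slight enlargement of `D`. Along lines through
a point of maximal modulus `x₀` it decays no faster than a cosine
(`norm_mul_cos_le_norm_integral_cexp`), so it is still comparable to its maximum at the samples near
`x₀`, less than a quarter period away. Averaging over a small ball around `x₀` produces the Voronoi
weights.

For `ℤ^d` and the unit cube, `𝓕 f` is given by its cardinal series along each coordinate line. The
one-variable energy inequalities are applied to one coordinate after another, each time rounding
that coordinate to the nearest integer. -/

noncomputable section

/-! ### Plancherel on `L¹ ∩ L²`, the decaying kernel and the reproducing formula. -/

namespace FourierSampling

/-- The Fourier transform is self-adjoint, for an integrable and a Schwartz function. -/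
theorem integral_fourier_mul_schwartz {V : Type*} [NormedAddCommGroup V] [InnerProductSpace ℝ V]
    [FiniteDimensional ℝ V] [MeasurableSpace V] [BorelSpace V] {f : V → ℂ} {g : V → ℂ}
    (hf : Integrable f) (hg : Integrable g) :
    ∫ ξ, 𝓕 f ξ * g ξ = ∫ x, f x * 𝓕 g x := by
  have := VectorFourier.integral_fourierIntegral_smul_eq_flip (L := innerₗ V) (μ := volume)
      (ν := volume) Real.continuous_fourierChar continuous_inner hf hg
  simpa using! this

/-- The `L²` Fourier transform of an integrable function is given by the Fourier integral. -/
theorem Lp_fourier_ae_eq {V : Type*} [NormedAddCommGroup V] [InnerProductSpace ℝ V]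
    [FiniteDimensional ℝ V] [MeasurableSpace V] [BorelSpace V] {f : V → ℂ}
    (hf : Integrable f) (hf2 : MemLp f 2) :
    (𝓕 (hf2.toLp f) : Lp ℂ 2 (volume : Measure V)) =ᵐ[volume] 𝓕 f := by
  have hcont : Continuous (𝓕 f) :=
    VectorFourier.fourierIntegral_continuous Real.continuous_fourierChar
      (by exact continuous_inner) hf
  -- Both sides are tested against smooth compactly supported functions. The `L²` transform agrees
  -- with the distributional one, so on both sides the transform moves onto the test function.
  refine ae_eq_of_integral_contDiff_smul_eq ?_ hcont.locallyIntegrable ?_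
  · exact (Lp.memLp _).locallyIntegrable (by norm_num)
  intro g hg hgs
  set φ : SchwartzMap V ℂ := (HasCompactSupport.toSchwartzMap (f := fun x => (g x : ℂ))
    (hgs.comp_left (g := fun x : ℝ => (x : ℂ)) (by simp)) (Complex.ofRealCLM.contDiff.comp hg)) with hφ
  have h1 := congrArg (fun T => T φ) (Lp.fourier_toTemperedDistribution_eq (hf2.toLp f))
  simp only [Lp.toTemperedDistribution_apply, TemperedDistribution.fourier_apply] at h1
  have h2 : ∫ x, (𝓕 φ) x • (hf2.toLp f) x = ∫ x, f x * 𝓕 (φ : V → ℂ) x := by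
    apply integral_congr_ae
    filter_upwards [hf2.coeFn_toLp] with x hx
    rw [hx, smul_eq_mul, mul_comm, SchwartzMap.fourier_coe]
  rw [h2, ← integral_fourier_mul_schwartz hf φ.integrable] at h1
  have h3 : ∀ x, φ x = (g x : ℂ) := fun x => rfl
  simp only [h3, smul_eq_mul] at h1
  simp only [Complex.real_smul]
  rw [← h1]
  congr 1 with x
  ring

theorem Lp_enorm_sq_eq {α : Type*} [MeasurableSpace α] {μ : Measure α} (f : Lp ℂ 2 μ) :
    ‖f‖ₑ ^ 2 = ∫⁻ x, ‖f x‖ₑ ^ 2 ∂μ := by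
  rw [Lp.enorm_def, eLpNorm_eq_lintegral_rpow_enorm_toReal (by norm_num) (by norm_num),
    ← ENNReal.rpow_natCast, ← ENNReal.rpow_mul]
  simp

/-- Plancherel's theorem for the Fourier integral on `L¹ ∩ L²`. -/
theorem lintegral_fourier_sq {V : Type*} [NormedAddCommGroup V] [InnerProductSpace ℝ V]
    [FiniteDimensional ℝ V] [MeasurableSpace V] [BorelSpace V] {f : V → ℂ}
    (hf : Integrable f) (hf2 : MemLp f 2) :
    ∫⁻ ξ, ‖𝓕 f ξ‖ₑ ^ 2 = ∫⁻ x, ‖f x‖ₑ ^ 2 := by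
  have h1 : ∫⁻ ξ, ‖𝓕 f ξ‖ₑ ^ 2 = ‖(𝓕 (hf2.toLp f) : Lp ℂ 2 (volume : Measure V))‖ₑ ^ 2 := by
    rw [Lp_enorm_sq_eq]
    apply lintegral_congr_ae
    filter_upwards [Lp_fourier_ae_eq hf hf2] with x hx
    rw [hx]
  have h2 : ∫⁻ x, ‖f x‖ₑ ^ 2 = ‖hf2.toLp f‖ₑ ^ 2 := by
    rw [Lp_enorm_sq_eq]
    apply lintegral_congr_ae
    filter_upwards [hf2.coeFn_toLp] with x hx
    rw [hx]
  rw [h1, h2, ← ofReal_norm, ← ofReal_norm, Lp.norm_fourier_eq]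

/-- A radial integrable kernel with polynomial decay. -/
def decayKernel (d : ℕ) (y : Space d) : ℝ≥0∞ :=
  ENNReal.ofReal ((1 + ‖y‖) ^ (-((d : ℝ) + 1)))

theorem measurable_decayKernel (d : ℕ) : Measurable (decayKernel d) := by
  unfold decayKernel
  fun_prop

theorem lintegral_decayKernel_lt_top (d : ℕ) : ∫⁻ y, decayKernel d y < ∞ := by
  have h : Integrable (fun y : Space d => (1 + ‖y‖) ^ (-((d : ℝ) + 1))) :=
    integrable_one_add_norm (by simp)
  exact h.lintegral_lt_top

/-- This is `1 + ‖y‖ ≤ (1 + ‖y + u‖)(1 + ‖u‖)` raised to the power `d + 1`. It lets the centre of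
the kernel move from a sample to any point of its cell at a bounded cost. -/
theorem decayKernel_add_le (d : ℕ) (y u : Space d) :
    decayKernel d (y + u) ≤ ENNReal.ofReal ((1 + ‖u‖) ^ ((d : ℝ) + 1)) * decayKernel d y := by
  unfold decayKernel
  rw [← ENNReal.ofReal_mul (by positivity)]
  apply ENNReal.ofReal_le_ofReal
  rw [Real.rpow_neg (by positivity), Real.rpow_neg (by positivity), ← div_eq_mul_inv,
    inv_eq_one_div, div_le_div_iff₀ (by positivity) (by positivity), one_mul,
    ← Real.mul_rpow (by positivity) (by positivity)]
  apply Real.rpow_le_rpow (by positivity) _ (by positivity)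
  have : ‖y‖ ≤ ‖y + u‖ + ‖u‖ := by
    simpa using norm_sub_le (y + u) u
  nlinarith [norm_nonneg u, norm_nonneg (y + u)]

/-- The mass of the kernel far away from the origin is small. -/
theorem exists_decayKernel_tail_le (d : ℕ) {η : ℝ≥0∞} (hη : 0 < η) :
    ∃ M : ℝ, 0 ≤ M ∧ ∫⁻ y in {y : Space d | M < ‖y‖}, decayKernel d y ≤ η := by
  have h : Filter.Tendsto (fun n : ℕ => ∫⁻ y in {y : Space d | (n : ℝ) < ‖y‖}, decayKernel d y)
      Filter.atTop (nhds 0) := by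
    have key := tendsto_measure_iInter_atTop (μ := volume.withDensity (decayKernel d))
      (s := fun n : ℕ => {y : Space d | (n : ℝ) < ‖y‖})
      (fun n => (measurableSet_lt measurable_const measurable_norm).nullMeasurableSet)
      (fun m n hmn y hy => lt_of_le_of_lt (Nat.cast_le.2 hmn : (m : ℝ) ≤ n) hy)
      ⟨0, by
        have := lintegral_decayKernel_lt_top d
        refine ne_of_lt (lt_of_le_of_lt (measure_mono (Set.subset_univ _)) ?_)
        rw [withDensity_apply _ MeasurableSet.univ]
        simpa using this⟩
    have he : (⋂ n : ℕ, {y : Space d | (n : ℝ) < ‖y‖}) = ∅ := by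
      ext y
      simp only [Set.mem_iInter, Set.mem_ofPred_eq, Set.mem_empty_iff_false, iff_false, not_forall,
        not_lt]
      exact exists_nat_ge ‖y‖
    rw [he, measure_empty] at key
    refine key.congr fun n => ?_
    simp only [Function.comp]
    rw [withDensity_apply _ (measurableSet_lt measurable_const measurable_norm)]
  obtain ⟨n, hn⟩ := ((tendsto_order.1 h).2 η hη).exists
  exact ⟨n, by positivity, hn.le⟩

theorem exists_schwartz_le_decayKernel {d : ℕ} (φ : SchwartzMap (Space d) ℂ) :
    ∃ C : ℝ, 0 < C ∧ ∀ y, ‖φ y‖ₑ ≤ ENNReal.ofReal C * decayKernel d y := by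
  have h := fun y => φ.one_add_le_sup_seminorm_apply (𝕜 := ℝ) (m := (d + 1, 0)) le_rfl le_rfl y
  set C := 2 ^ (d + 1) * ((Finset.Iic ((d + 1 : ℕ), (0 : ℕ))).sup
    (fun m => SchwartzMap.seminorm ℝ (E := Space d) (F := ℂ) m.1 m.2)) φ
  refine ⟨|C| + 1, by positivity, fun y => ?_⟩
  have hy := h y
  rw [norm_iteratedFDeriv_zero] at hy
  rw [decayKernel, ← ENNReal.ofReal_mul (by positivity), ← ofReal_norm]
  apply ENNReal.ofReal_le_ofReal
  rw [Real.rpow_neg (by positivity), ← div_eq_mul_inv, le_div_iff₀ (by positivity), mul_comm]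
  have : ((1 + ‖y‖) ^ ((d : ℝ) + 1)) = (1 + ‖y‖) ^ (d + 1) := by
    rw [← Real.rpow_natCast]; push_cast; rfl
  rw [this]
  exact hy.trans ((le_abs_self C).trans (by linarith))

/-- The Fourier transform of a function supported in a ball is reproduced by convolution with a
Schwartz function. -/
theorem exists_reproducing_schwartz (d : ℕ) (ρ : ℝ) :
    ∃ φ : SchwartzMap (Space d) ℂ, ∀ f : Space d → ℂ, Integrable f →
      (∀ᵐ x, ρ < ‖x‖ → f x = 0) → ∀ ω, 𝓕 f ω = ∫ ξ, 𝓕 f ξ * φ (ω - ξ) := by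
  -- The bump is one on a ball containing the support of `f`, so `f = f * χ`, and `𝓕 χ` is the
  -- reproducing kernel. The absolute value keeps the radii positive for every real `ρ`.
  let b : ContDiffBump (0 : Space d) := ⟨|ρ| + 1, |ρ| + 2, by positivity, by linarith⟩
  let χ : SchwartzMap (Space d) ℂ := HasCompactSupport.toSchwartzMap (f := fun x => (b x : ℂ))
    (b.hasCompactSupport.comp_left (g := fun x : ℝ => (x : ℂ)) (by simp))
    (Complex.ofRealCLM.contDiff.comp b.contDiff)
  have hχ : ∀ x, ‖x‖ ≤ ρ → χ x = 1 := by
    intro x hx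
    have : b x = 1 := b.one_of_mem_closedBall (by
      simp only [Metric.mem_closedBall, dist_zero_right]
      exact hx.trans ((le_abs_self ρ).trans (by change |ρ| ≤ |ρ| + 1; linarith)))
    change ((b x : ℝ) : ℂ) = 1
    rw [this]; simp
  refine ⟨𝓕 χ, fun f hf hfs ω => ?_⟩
  have hi : Integrable (fun ξ => (𝓕 χ : SchwartzMap (Space d) ℂ) (ω - ξ)) :=
    (𝓕 χ : SchwartzMap (Space d) ℂ).integrable.comp_sub_left ω
  rw [integral_fourier_mul_schwartz hf hi, Real.fourier_eq]
  apply integral_congr_ae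
  filter_upwards [hfs] with x hx
  have hinv : 𝓕⁻ (𝓕 χ : SchwartzMap (Space d) ℂ) x = χ x := by
    rw [FourierTransform.fourierInv_fourier_eq]
  rw [SchwartzMap.fourierInv_coe, Real.fourierInv_eq] at hinv
  -- By Fourier inversion the translated and reflected kernel transforms back to a modulation of
  -- `χ`.
  have key : 𝓕 (fun ξ => (𝓕 χ : SchwartzMap (Space d) ℂ) (ω - ξ)) x
      = Real.fourierChar (-inner ℝ x ω) • χ x := by
    rw [Real.fourier_eq, ← hinv, ← integral_sub_left_eq_self _ _ ω, Circle.smul_def,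
      ← integral_smul]
    congr 1 with ξ
    rw [sub_sub_cancel, ← Circle.smul_def, smul_smul, ← AddChar.map_add_eq_mul]
    congr 3
    rw [inner_sub_left, real_inner_comm ω x]
    ring
  rw [key]
  by_cases hxρ : ‖x‖ ≤ ρ
  · rw [hχ x hxρ, Circle.smul_def, Circle.smul_def]
    simp [mul_comm]
  · rw [hx (lt_of_not_ge hxρ)]; simp

theorem continuous_fourier {V : Type*} [NormedAddCommGroup V] [InnerProductSpace ℝ V]
    [FiniteDimensional ℝ V] [MeasurableSpace V] [BorelSpace V] {f : V → ℂ}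
    (hf : Integrable f) : Continuous (𝓕 f) :=
  VectorFourier.fourierIntegral_continuous Real.continuous_fourierChar
    (by exact continuous_inner) hf

/-- Weighted Cauchy–Schwarz inequality. -/
theorem lintegral_mul_sq_le {α : Type*} [MeasurableSpace α] {μ : Measure α} {a k : α → ℝ≥0∞}
    (ha : AEMeasurable a μ) (hk : AEMeasurable k μ) :
    (∫⁻ x, a x * k x ∂μ) ^ 2 ≤ (∫⁻ x, k x ∂μ) * ∫⁻ x, a x ^ 2 * k x ∂μ := by
  have h := ENNReal.lintegral_mul_le_Lp_mul_Lq μ Real.HolderConjugate.two_two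
    (hk.pow_const (1 / 2 : ℝ)) (ha.mul (hk.pow_const (1 / 2 : ℝ)))
  have hs : ∀ c : ℝ≥0∞, c ^ (1 / 2 : ℝ) * c ^ (1 / 2 : ℝ) = c := by
    intro c
    rw [← ENNReal.rpow_add_of_nonneg _ _ (by norm_num) (by norm_num)]; norm_num
  have e1 : ∫⁻ x, ((fun x => k x ^ (1 / 2 : ℝ)) * (a * fun x => k x ^ (1 / 2 : ℝ))) x ∂μ
      = ∫⁻ x, a x * k x ∂μ := by
    congr 1 with x
    simp only [Pi.mul_apply]
    rw [mul_left_comm, hs]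
  have e2 : ∀ x, (k x ^ (1 / 2 : ℝ)) ^ (2 : ℝ) = k x := by
    intro x
    rw [← ENNReal.rpow_mul]; norm_num
  rw [e1] at h
  simp only [Pi.mul_apply, ENNReal.mul_rpow_of_nonneg _ _ (zero_le_two (α := ℝ)), e2] at h
  have h2 := pow_le_pow_left₀ zero_le h 2
  refine h2.trans (le_of_eq ?_)
  rw [mul_pow, ← ENNReal.rpow_natCast, ← ENNReal.rpow_natCast, ← ENNReal.rpow_mul,
    ← ENNReal.rpow_mul]
  norm_num

/-- Local control of the Fourier transform of a function supported in a ball. -/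
theorem exists_enorm_fourier_sq_le (d : ℕ) (ρ r : ℝ) :
    ∃ C : ℝ, 0 < C ∧ ∀ f : Space d → ℂ, Integrable f → (∀ᵐ x, ρ < ‖x‖ → f x = 0) →
      ∀ ω z, ‖ω - z‖ ≤ r →
        ‖𝓕 f ω‖ₑ ^ 2 ≤ ENNReal.ofReal C * ∫⁻ ξ, ‖𝓕 f ξ‖ₑ ^ 2 * decayKernel d (z - ξ) := by
  obtain ⟨φ, hφ⟩ := exists_reproducing_schwartz d ρ
  obtain ⟨C₀, hC₀, hdec⟩ := exists_schwartz_le_decayKernel φ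
  set J := ∫⁻ y, decayKernel d y with hJ
  have hJt : J < ∞ := lintegral_decayKernel_lt_top d
  set B : ℝ := (1 + |r|) ^ ((d : ℝ) + 1) with hB
  have hBpos : 0 < B := by positivity
  -- The square of `C₀` comes from the Schwartz bound, `J` from Cauchy–Schwarz against the kernel,
  -- and `B` from moving its centre from `ω` to `z`. The `+ 1` only makes the constant visibly
  -- positive.
  refine ⟨C₀ * C₀ * B * (J.toReal + 1), by positivity, fun f hf hfs ω z hωz => ?_⟩
  have hm : Measurable (fun ξ => ‖𝓕 f ξ‖ₑ) := (continuous_fourier hf).measurable.enorm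
  have hk : Measurable (fun ξ => decayKernel d (ω - ξ)) :=
    (measurable_decayKernel d).comp (measurable_const.sub measurable_id)
  have h1 : ‖𝓕 f ω‖ₑ ≤ ENNReal.ofReal C₀ * ∫⁻ ξ, ‖𝓕 f ξ‖ₑ * decayKernel d (ω - ξ) := by
    have hmk : Measurable (fun ξ => ‖𝓕 f ξ‖ₑ * decayKernel d (ω - ξ)) := hm.mul hk
    rw [hφ f hf hfs ω, ← lintegral_const_mul _ hmk]
    refine (enorm_integral_le_lintegral_enorm _).trans (lintegral_mono fun ξ => ?_)
    rw [enorm_mul, mul_left_comm]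
    exact mul_le_mul_right (hdec _) _
  have h2 := lintegral_mul_sq_le (μ := volume) hm.aemeasurable hk.aemeasurable
  have h3 : ∫⁻ ξ, decayKernel d (ω - ξ) = J := lintegral_sub_left_eq_self _ _
  have h4 : ∫⁻ ξ, ‖𝓕 f ξ‖ₑ ^ 2 * decayKernel d (ω - ξ) ≤
      ENNReal.ofReal B * ∫⁻ ξ, ‖𝓕 f ξ‖ₑ ^ 2 * decayKernel d (z - ξ) := by
    rw [← lintegral_const_mul]
    · refine lintegral_mono fun ξ => ?_
      rw [mul_left_comm]
      refine mul_le_mul_right ?_ _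
      have := decayKernel_add_le d (z - ξ) (ω - z)
      rw [show z - ξ + (ω - z) = ω - ξ by abel] at this
      refine this.trans (mul_le_mul_left ?_ _)
      apply ENNReal.ofReal_le_ofReal
      apply Real.rpow_le_rpow (by positivity) _ (by positivity)
      linarith [le_abs_self r]
    · exact (hm.pow_const 2).mul ((measurable_decayKernel d).comp
        (measurable_const.sub measurable_id))
  calc ‖𝓕 f ω‖ₑ ^ 2
      ≤ (ENNReal.ofReal C₀ * ∫⁻ ξ, ‖𝓕 f ξ‖ₑ * decayKernel d (ω - ξ)) ^ 2 := by gcongr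
    _ ≤ ENNReal.ofReal C₀ ^ 2 * (J * (ENNReal.ofReal B *
          ∫⁻ ξ, ‖𝓕 f ξ‖ₑ ^ 2 * decayKernel d (z - ξ))) := by
        rw [mul_pow]
        refine mul_le_mul_right ?_ _
        refine h2.trans ?_
        rw [h3]
        exact mul_le_mul_right h4 _
    _ ≤ _ := by
        rw [← mul_assoc, ← mul_assoc]
        refine mul_le_mul_left ?_ _
        rw [ENNReal.ofReal_mul (by positivity), ENNReal.ofReal_mul (by positivity),
          ENNReal.ofReal_mul (by positivity)]
        have : J ≤ ENNReal.ofReal (J.toReal + 1) := by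
          rw [ENNReal.ofReal_add (by positivity) (by positivity), ENNReal.ofReal_toReal hJt.ne]
          exact le_self_add
        calc ENNReal.ofReal C₀ ^ 2 * J * ENNReal.ofReal B
            = ENNReal.ofReal C₀ * ENNReal.ofReal C₀ * ENNReal.ofReal B * J := by ring
          _ ≤ _ := mul_le_mul_right this _

end FourierSampling

/-! ### Sums over cells and smoothed energies. -/

namespace FourierSampling

/-- A weighted sum of samples over almost disjoint cells is controlled by a smoothed energy. -/
theorem exists_tsum_cells_le (d : ℕ) (ρ r : ℝ) :
    ∃ C : ℝ, 0 < C ∧ ∀ f : Space d → ℂ, Integrable f → (∀ᵐ x, ρ < ‖x‖ → f x = 0) →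
      ∀ (ι : Type) [Countable ι] (p : ι → Space d) (W : ι → Set (Space d)) (S : Set (Space d)),
        (∀ i, MeasurableSet (W i)) → Pairwise (Function.onFun (AEDisjoint volume) W) →
        (∀ i, ∀ z ∈ W i, ‖p i - z‖ ≤ r) → (∀ i, W i ⊆ S) →
        ∑' i, volume (W i) * ‖𝓕 f (p i)‖ₑ ^ 2 ≤
          ENNReal.ofReal C * ∫⁻ ξ, ‖𝓕 f ξ‖ₑ ^ 2 * ∫⁻ z in S, decayKernel d (z - ξ) := by
  obtain ⟨C, hC, h⟩ := exists_enorm_fourier_sq_le d ρ r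
  refine ⟨C, hC, fun f hf hfs ι _ p W S hW hWd hWr hWS => ?_⟩
  have hm : Measurable (fun ξ => ‖𝓕 f ξ‖ₑ) := (continuous_fourier hf).measurable.enorm
  have hk : Measurable (fun q : Space d × Space d => ‖𝓕 f q.2‖ₑ ^ 2 * decayKernel d (q.1 - q.2)) :=
    ((hm.comp measurable_snd).pow_const 2).mul ((measurable_decayKernel d).comp
      (measurable_fst.sub measurable_snd))
  -- The pointwise bound holds for every centre `z` in `W i`, so the weight `volume (W i)` becomes
  -- integration over the cell. Disjointness merges the cells into one integral over `S`, and
  -- Tonelli exchanges it with the frequency integral.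
  calc ∑' i, volume (W i) * ‖𝓕 f (p i)‖ₑ ^ 2
      ≤ ∑' i, ∫⁻ z in W i, ENNReal.ofReal C *
          ∫⁻ ξ, ‖𝓕 f ξ‖ₑ ^ 2 * decayKernel d (z - ξ) := by
        refine ENNReal.tsum_le_tsum fun i => ?_
        rw [mul_comm, ← setLIntegral_const]
        exact setLIntegral_mono' (hW i) fun z hz => h f hf hfs _ _ (hWr i z hz)
    _ = ∫⁻ z in ⋃ i, W i, ENNReal.ofReal C *
          ∫⁻ ξ, ‖𝓕 f ξ‖ₑ ^ 2 * decayKernel d (z - ξ) :=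
        (lintegral_iUnion₀ (fun i => (hW i).nullMeasurableSet) hWd _).symm
    _ ≤ ∫⁻ z in S, ENNReal.ofReal C * ∫⁻ ξ, ‖𝓕 f ξ‖ₑ ^ 2 * decayKernel d (z - ξ) :=
        lintegral_mono_set (Set.iUnion_subset hWS)
    _ = ENNReal.ofReal C * ∫⁻ z in S, ∫⁻ ξ, ‖𝓕 f ξ‖ₑ ^ 2 * decayKernel d (z - ξ) :=
        lintegral_const_mul' _ _ ENNReal.ofReal_ne_top
    _ = ENNReal.ofReal C * ∫⁻ ξ, ‖𝓕 f ξ‖ₑ ^ 2 * ∫⁻ z in S, decayKernel d (z - ξ) := by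
        rw [lintegral_lintegral_swap hk.aemeasurable]
        congr 1
        refine lintegral_congr fun ξ => ?_
        rw [lintegral_const_mul' _ _ (by finiteness)]

/-- Bessel's inequality for samples weighted by almost disjoint cells of bounded size. -/
theorem exists_tsum_cells_le_lintegral (d : ℕ) (ρ r : ℝ) :
    ∃ C : ℝ, 0 < C ∧ ∀ f : Space d → ℂ, Integrable f → (∀ᵐ x, ρ < ‖x‖ → f x = 0) →
      ∀ (ι : Type) [Countable ι] (p : ι → Space d) (W : ι → Set (Space d)),
        (∀ i, MeasurableSet (W i)) → Pairwise (Function.onFun (AEDisjoint volume) W) →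
        (∀ i, ∀ z ∈ W i, ‖p i - z‖ ≤ r) →
        ∑' i, volume (W i) * ‖𝓕 f (p i)‖ₑ ^ 2 ≤ ENNReal.ofReal C * ∫⁻ ξ, ‖𝓕 f ξ‖ₑ ^ 2 := by
  obtain ⟨C, hC, h⟩ := exists_tsum_cells_le d ρ r
  set J := ∫⁻ y, decayKernel d y with hJ
  have hJt : J < ∞ := lintegral_decayKernel_lt_top d
  refine ⟨C * (J.toReal + 1), by positivity, fun f hf hfs ι _ p W hW hWd hWr => ?_⟩
  refine (h f hf hfs ι p W Set.univ hW hWd hWr fun i => Set.subset_univ _).trans ?_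
  have e : ∀ ξ, ∫⁻ z in Set.univ, decayKernel d (z - ξ) = J := fun ξ => by
    rw [Measure.restrict_univ]; exact lintegral_sub_right_eq_self _ _
  simp only [e]
  rw [lintegral_mul_const' _ _ hJt.ne, ENNReal.ofReal_mul hC.le, mul_assoc]
  refine mul_le_mul_right ?_ _
  rw [mul_comm]
  refine mul_le_mul_left ?_ _
  rw [ENNReal.ofReal_add (by positivity) (by positivity), ENNReal.ofReal_toReal hJt.ne]
  exact le_self_add

/-- Samples at bounded frequencies are controlled by the low-frequency energy, up to a small
error. -/
theorem exists_tsum_cells_le_setLIntegral (d : ℕ) (ρ r : ℝ) :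
    ∃ C : ℝ, 0 < C ∧ ∀ η : ℝ, 0 < η → ∃ M : ℝ, 0 ≤ M ∧
      ∀ (K : ℝ) (f : Space d → ℂ), Integrable f → (∀ᵐ x, ρ < ‖x‖ → f x = 0) →
      ∀ (ι : Type) [Countable ι] (p : ι → Space d) (W : ι → Set (Space d)),
        (∀ i, MeasurableSet (W i)) → Pairwise (Function.onFun (AEDisjoint volume) W) →
        (∀ i, ∀ z ∈ W i, ‖p i - z‖ ≤ r) → (∀ i, ‖p i‖ ≤ K) →
        ∑' i, volume (W i) * ‖𝓕 f (p i)‖ₑ ^ 2 ≤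
          ENNReal.ofReal C * (∫⁻ ξ in Metric.closedBall 0 (K + M), ‖𝓕 f ξ‖ₑ ^ 2)
            + ENNReal.ofReal η * ∫⁻ ξ, ‖𝓕 f ξ‖ₑ ^ 2 := by
  obtain ⟨C, hC, h⟩ := exists_tsum_cells_le d ρ r
  set J := ∫⁻ y, decayKernel d y with hJ
  have hJt : J < ∞ := lintegral_decayKernel_lt_top d
  refine ⟨C * (J.toReal + 1), by positivity, fun η hη => ?_⟩
  obtain ⟨M, hM, htail⟩ := exists_decayKernel_tail_le d (η := ENNReal.ofReal (η / C))
    (by rw [ENNReal.ofReal_pos]; positivity)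
  -- All cells lie in the ball of radius `K + r`. A frequency outside radius `K + M + |r|` is at
  -- distance more than `M` from that ball and sees only the tail of the kernel, of mass at most `η
  -- / C`.
  refine ⟨M + |r|, by positivity, fun K f hf hfs ι _ p W hW hWd hWr hpK => ?_⟩
  have hm : Measurable (fun ξ => ‖𝓕 f ξ‖ₑ) := (continuous_fourier hf).measurable.enorm
  refine (h f hf hfs ι p W (Metric.closedBall 0 (K + r)) hW hWd hWr ?_).trans ?_
  · intro i z hz
    rw [mem_closedBall_zero_iff]
    have h1 := hWr i z hz
    have h2 := hpK i
    have h3 : ‖z‖ ≤ ‖p i‖ + ‖p i - z‖ := by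
      simpa using norm_sub_le (p i) (p i - z)
    linarith
  have hin : ∀ ξ, ∫⁻ z in Metric.closedBall 0 (K + r), decayKernel d (z - ξ) ≤ J := fun ξ =>
    (setLIntegral_le_lintegral _ _).trans (lintegral_sub_right_eq_self _ _).le
  have hout : ∀ ξ : Space d, ξ ∉ Metric.closedBall 0 (K + (M + |r|)) →
      ∫⁻ z in Metric.closedBall 0 (K + r), decayKernel d (z - ξ) ≤ ENNReal.ofReal (η / C) := by
    intro ξ hξ
    refine le_trans ?_ htail
    have hms : MeasurableSet {y : Space d | M < ‖y‖} :=
      measurableSet_lt measurable_const measurable_norm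
    rw [← lintegral_indicator hms,
      ← lintegral_sub_right_eq_self (μ := (volume : Measure (Space d)))
        ({y : Space d | M < ‖y‖}.indicator (decayKernel d)) ξ,
      ← lintegral_indicator Metric.isClosed_closedBall.measurableSet]
    refine lintegral_mono fun z => ?_
    by_cases hz : z ∈ Metric.closedBall (0 : Space d) (K + r)
    · rw [Set.indicator_of_mem hz, Set.indicator_of_mem]
      rw [mem_closedBall_zero_iff] at hz hξ
      have h3 : ‖ξ‖ ≤ ‖z‖ + ‖z - ξ‖ := by
        simpa using norm_sub_le z (z - ξ)
      have := le_abs_self r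
      change M < ‖z - ξ‖
      linarith
    · rw [Set.indicator_of_notMem hz]; exact zero_le
  have hbs : MeasurableSet (Metric.closedBall (0 : Space d) (K + (M + |r|))) :=
    Metric.isClosed_closedBall.measurableSet
  rw [← lintegral_add_compl _ hbs, mul_add]
  refine add_le_add ?_ ?_
  · rw [ENNReal.ofReal_mul hC.le, mul_assoc]
    refine mul_le_mul_right ?_ _
    rw [← lintegral_const_mul' _ _ ENNReal.ofReal_ne_top]
    refine lintegral_mono fun ξ => ?_
    rw [mul_comm]
    refine mul_le_mul_left ((hin ξ).trans ?_) _
    rw [ENNReal.ofReal_add (by positivity) (by positivity), ENNReal.ofReal_toReal hJt.ne]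
    exact le_self_add
  · have : ENNReal.ofReal η = ENNReal.ofReal C * ENNReal.ofReal (η / C) := by
      rw [← ENNReal.ofReal_mul hC.le]; congr 1; field_simp
    rw [this, mul_assoc]
    refine mul_le_mul_right ?_ _
    rw [← lintegral_const_mul' _ _ ENNReal.ofReal_ne_top]
    refine (setLIntegral_mono' hbs.compl fun ξ hξ => ?_).trans (setLIntegral_le_lintegral _ _)
    rw [mul_comm]
    exact mul_le_mul_left (hout ξ hξ) _

/-! ### Polar norms and Voronoi regions -/

section Geometry

variable {d : ℕ} {D : Set (Space d)}

theorem IsCenteredSymmConvexBody.exists_closedBall_subset (hD : IsCenteredSymmConvexBody D) :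
    ∃ r : ℝ, 0 < r ∧ Metric.closedBall 0 r ⊆ D :=
  Metric.nhds_basis_closedBall.mem_iff.1 (mem_interior_iff_mem_nhds.1 hD.zero_mem_interior)

theorem IsCenteredSymmConvexBody.exists_norm_le (hD : IsCenteredSymmConvexBody D) :
    ∃ R : ℝ, 0 < R ∧ ∀ x ∈ D, ‖x‖ ≤ R := by
  obtain ⟨R, hR⟩ := hD.isCompact.isBounded.exists_norm_le
  exact ⟨max R 1, by positivity, fun x hx => (hR x hx).trans (le_max_left _ _)⟩

theorem convex_polarSet (D : Set (Space d)) : Convex ℝ (polarSet D) := by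
  intro x hx y hy a b ha hb hab u hu
  rw [inner_add_right, inner_smul_right, inner_smul_right]
  nlinarith [hx u hu, hy u hu]

theorem polarSet_mem_nhds (hD : IsCenteredSymmConvexBody D) : polarSet D ∈ nhds (0 : Space d) := by
  obtain ⟨R, hR, h⟩ := hD.exists_norm_le
  refine Filter.mem_of_superset (Metric.closedBall_mem_nhds 0 (inv_pos.2 hR)) fun z hz x hx => ?_
  rw [mem_closedBall_zero_iff] at hz
  calc inner ℝ x z ≤ ‖x‖ * ‖z‖ := real_inner_le_norm _ _
    _ ≤ R * R⁻¹ := by gcongr; exact h x hx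
    _ = 1 := mul_inv_cancel₀ hR.ne'

/-- With `gauge_polarSet_le`, this makes the norm of the polar the support function of `D`. Its
comparison with the Euclidean norm and the control of spectra along lines both rest on this
description. -/
theorem inner_le_gauge_polarSet (hD : IsCenteredSymmConvexBody D) {x y : Space d} (hx : x ∈ D) :
    inner ℝ x y ≤ gauge (polarSet D) y := by
  refine le_of_forall_gt fun a ha => ?_
  obtain ⟨b, hb, hba, hy⟩ := exists_lt_of_gauge_lt
    (absorbent_nhds_zero (𝕜 := ℝ) (polarSet_mem_nhds hD)) ha
  obtain ⟨z, hz, rfl⟩ := hy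
  refine lt_of_le_of_lt ?_ hba
  simp only [inner_smul_right]
  nlinarith [hz x hx]

theorem gauge_polarSet_le {y : Space d} {a : ℝ} (ha : 0 ≤ a)
    (h : ∀ x ∈ D, inner ℝ x y ≤ a) : gauge (polarSet D) y ≤ a := by
  refine le_of_forall_pos_le_add fun ε hε => ?_
  refine gauge_le_of_mem (by positivity) ⟨(a + ε)⁻¹ • y, fun x hx => ?_, ?_⟩
  · rw [inner_smul_right, inv_mul_le_iff₀ (by positivity)]
    linarith [h x hx]
  · exact smul_inv_smul₀ (by positivity) y

theorem gauge_polarSet_le_mul_norm {R : ℝ} (hR : 0 ≤ R) (h : ∀ x ∈ D, ‖x‖ ≤ R)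
    (y : Space d) : gauge (polarSet D) y ≤ R * ‖y‖ :=
  gauge_polarSet_le (by positivity) fun x hx =>
    (real_inner_le_norm _ _).trans (by gcongr; exact h x hx)

theorem mul_norm_le_gauge_polarSet (hD : IsCenteredSymmConvexBody D) {r : ℝ} (hr : 0 < r)
    (h : Metric.closedBall 0 r ⊆ D) (y : Space d) : r * ‖y‖ ≤ gauge (polarSet D) y := by
  by_cases hy : y = 0
  · simp [hy]
  have hy' : 0 < ‖y‖ := norm_pos_iff.2 hy
  have hx : (r / ‖y‖) • y ∈ D := h (by
    rw [mem_closedBall_zero_iff, norm_smul, Real.norm_of_nonneg (by positivity)]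
    field_simp; rfl)
  refine le_trans (le_of_eq ?_) (inner_le_gauge_polarSet hD hx)
  rw [real_inner_smul_left, real_inner_self_eq_norm_sq]
  field_simp

theorem continuous_gauge_polarSet (hD : IsCenteredSymmConvexBody D) :
    Continuous (gauge (polarSet D)) :=
  continuous_gauge (convex_polarSet D) (polarSet_mem_nhds hD)

theorem isClosed_voronoiRegion (hD : IsCenteredSymmConvexBody D) (Ω : Set (Space d))
    (ω : Space d) : IsClosed (voronoiRegion (polarSet D) Ω ω) := by
  have hc := continuous_gauge_polarSet hD
  have : voronoiRegion (polarSet D) Ω ω = ⋂ ν ∈ Ω, ⋂ _ : ν ≠ ω,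
      {z | gauge (polarSet D) (ω - z) ≤ gauge (polarSet D) (ν - z)} := by
    ext z; simp [voronoiRegion]
  rw [this]
  refine isClosed_biInter fun ν _ => isClosed_iInter fun _ => isClosed_le ?_ ?_
  · exact hc.comp (continuous_const.sub continuous_id)
  · exact hc.comp (continuous_const.sub continuous_id)

theorem gauge_sub_le_of_mem_voronoiRegion {B Ω : Set (Space d)} {ω z ν : Space d}
    (hz : z ∈ voronoiRegion B Ω ω) (hν : ν ∈ Ω) : gauge B (ω - z) ≤ gauge B (ν - z) := by
  by_cases h : ν = ω
  · rw [h]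
  · exact hz ν hν h

theorem gauge_sub_le_gap {B Ω : Set (Space d)} {ω z : Space d}
    (hz : z ∈ voronoiRegion B Ω ω) : ENNReal.ofReal (gauge B (ω - z)) ≤ gap B Ω := by
  refine le_trans ?_ (le_iSup (fun z : Space d => ⨅ ω ∈ Ω, ENNReal.ofReal (gauge B (ω - z))) z)
  exact le_iInf₂ fun ν hν => ENNReal.ofReal_le_ofReal (gauge_sub_le_of_mem_voronoiRegion hz hν)

theorem nonempty_of_gap_lt_top {B Ω : Set (Space d)} (h : gap B Ω < ⊤) : Ω.Nonempty := by
  by_contra hne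
  rw [Set.not_nonempty_iff_eq_empty] at hne
  subst hne
  simp [gap] at h

/-- Every point lies in some Voronoi region of a nonempty closed set. -/
theorem exists_mem_voronoiRegion (hD : IsCenteredSymmConvexBody D) {Ω : Set (Space d)}
    (hΩ : IsClosed Ω) (hne : Ω.Nonempty) (z : Space d) :
    ∃ ω ∈ Ω, z ∈ voronoiRegion (polarSet D) Ω ω := by
  obtain ⟨ω₀, hω₀⟩ := hne
  obtain ⟨r, hr, hrD⟩ := hD.exists_closedBall_subset
  have hc : Continuous fun ω => gauge (polarSet D) (ω - z) :=
    (continuous_gauge_polarSet hD).comp (continuous_id.sub continuous_const)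
  -- Coercivity of the polar norm together with closedness of `Ω` yields a nearest point.
  have ht : Filter.Tendsto (fun ω => gauge (polarSet D) (ω - z))
      (Filter.cocompact (Space d)) Filter.atTop := by
    refine Filter.tendsto_atTop_mono (fun ω => mul_norm_le_gauge_polarSet hD hr hrD (ω - z)) ?_
    refine Filter.Tendsto.const_mul_atTop hr ?_
    refine Filter.tendsto_atTop_mono (fun ω => norm_sub_norm_le ω z) ?_
    exact Filter.tendsto_atTop_add_const_right _ _ (tendsto_norm_cocompact_atTop (E := Space d))
  obtain ⟨ω, hω, hmin⟩ := hc.continuousOn.exists_isMinOn' hΩ hω₀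
    ((ht.eventually_ge_atTop _).filter_mono inf_le_left)
  exact ⟨ω, hω, fun ν hν _ => hmin hν⟩

/-- Voronoi regions of a set with finite gap have bounded radius. -/
theorem exists_norm_sub_le_of_mem_voronoiRegion (hD : IsCenteredSymmConvexBody D)
    {Ω : Set (Space d)} (hgap : gap (Metric.closedBall 0 1) Ω < ⊤) :
    ∃ r : ℝ, ∀ ω, ∀ z ∈ voronoiRegion (polarSet D) Ω ω, ‖ω - z‖ ≤ r := by
  obtain ⟨r, hr, hrD⟩ := hD.exists_closedBall_subset
  obtain ⟨R, hR, hRD⟩ := hD.exists_norm_le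
  set g := (gap (Metric.closedBall 0 1) Ω).toReal
  refine ⟨R * (g + 1) / r, fun ω z hz => ?_⟩
  have h1 : (⨅ ν ∈ Ω, ENNReal.ofReal (gauge (Metric.closedBall 0 1) (ν - z))) <
      ENNReal.ofReal (g + 1) := by
    refine lt_of_le_of_lt (le_iSup (fun z : Space d => ⨅ ν ∈ Ω,
      ENNReal.ofReal (gauge (Metric.closedBall 0 1) (ν - z))) z) ?_
    change gap (Metric.closedBall 0 1) Ω < _
    rw [ENNReal.lt_ofReal_iff_toReal_lt hgap.ne]
    linarith
  simp only [iInf_lt_iff] at h1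
  obtain ⟨ν, hν, hlt⟩ := h1
  rw [gauge_closedBall zero_le_one, div_one, ENNReal.ofReal_lt_ofReal_iff (by positivity)] at hlt
  rw [le_div_iff₀ hr, mul_comm]
  calc r * ‖ω - z‖ ≤ gauge (polarSet D) (ω - z) := mul_norm_le_gauge_polarSet hD hr hrD _
    _ ≤ gauge (polarSet D) (ν - z) := gauge_sub_le_of_mem_voronoiRegion hz hν
    _ ≤ R * ‖ν - z‖ := gauge_polarSet_le_mul_norm hR.le hRD _
    _ ≤ R * (g + 1) := by gcongr

end Geometry

/-- The functions of norm one in `L²(D)` are integrable and their transforms have energy one. -/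
theorem Lp.integrable_of_ae_support {d : ℕ} {R : ℝ} {f : Lp ℂ 2 (volume : Measure (Space d))}
    (hf : ∀ᵐ x : Space d, R < ‖x‖ → f x = 0) : Integrable (fun x => f x) := by
  have h1 : IntegrableOn (fun x => f x) (Metric.closedBall (0 : Space d) R) := by
    have : IsFiniteMeasure ((volume : Measure (Space d)).restrict (Metric.closedBall 0 R)) :=
      ⟨by rw [Measure.restrict_apply_univ]; exact measure_closedBall_lt_top⟩
    exact ((Lp.memLp f).restrict _).integrable (by norm_num)
  refine h1.integrable_of_ae_notMem_eq_zero ?_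
  filter_upwards [hf] with x hx hxR
  exact hx (by simpa using hxR)

theorem Lp.lintegral_fourier_sq_eq_one {d : ℕ} {f : Lp ℂ 2 (volume : Measure (Space d))}
    (hi : Integrable (fun x => f x)) (h1 : ‖f‖ = 1) :
    ∫⁻ ξ, ‖𝓕 (fun x => f x) ξ‖ₑ ^ 2 = 1 := by
  rw [lintegral_fourier_sq hi (Lp.memLp f), ← Lp_enorm_sq_eq, ← ofReal_norm, h1]
  simp

/-- The sampling sum over `Ω` is controlled by the low-frequency energy. -/
theorem exists_sampling_le {d : ℕ} {D : Set (Space d)} (hD : IsCenteredSymmConvexBody D)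
    {Ω : Set (Space d)} (hΩ_countable : Ω.Countable)
    (hΩ_voronoi : HasAlmostDisjointVoronoi (polarSet D) Ω)
    (hΩ_gap : gap (Metric.closedBall 0 1) Ω < ⊤) :
    ∃ C : ℝ, 0 < C ∧ ∀ η : ℝ, 0 < η → ∃ M : ℝ, 0 ≤ M ∧
      ∀ (K : ℝ) (f : Lp ℂ 2 (volume : Measure (Space d))),
      (∀ᵐ x : Space d, x ∉ D → f x = 0) → ‖f‖ = 1 →
        ∑' ω : {ω : Space d // ω ∈ Ω ∧ ‖ω‖ ≤ K},
          voronoiWeight (polarSet D) Ω ω * ‖𝓕 (fun x : Space d => f x) (ω : Space d)‖ₑ ^ 2 ≤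
        ENNReal.ofReal C *
            (∫⁻ ξ in Metric.closedBall 0 (K + M), ‖𝓕 (fun x : Space d => f x) ξ‖ₑ ^ 2)
          + ENNReal.ofReal η := by
  obtain ⟨R, hR, hRD⟩ := hD.exists_norm_le
  obtain ⟨r, hr⟩ := exists_norm_sub_le_of_mem_voronoiRegion hD hΩ_gap
  obtain ⟨C, hC, h⟩ := exists_tsum_cells_le_setLIntegral d R r
  refine ⟨C, hC, fun η hη => ?_⟩
  obtain ⟨M, hM, h⟩ := h η hη
  refine ⟨M, hM, fun K f hf hf1 => ?_⟩
  have hfR : ∀ᵐ x : Space d, R < ‖x‖ → f x = 0 := by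
    filter_upwards [hf] with x hx hxR
    exact hx fun hxD => absurd (hRD x hxD) (not_le.2 hxR)
  have hi := Lp.integrable_of_ae_support hfR
  have : Countable {ω : Space d // ω ∈ Ω ∧ ‖ω‖ ≤ K} :=
    (hΩ_countable.mono (s₁ := {ω | ω ∈ Ω ∧ ‖ω‖ ≤ K}) fun _ hx => hx.1).to_subtype
  have := h K (fun x => f x) hi hfR {ω : Space d // ω ∈ Ω ∧ ‖ω‖ ≤ K} (fun ω => ω)
    (fun ω => voronoiRegion (polarSet D) Ω ω)
    (fun ω => (isClosed_voronoiRegion hD Ω ω).measurableSet)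
    (fun ω ν hne => hΩ_voronoi ω ω.2.1 ν ν.2.1 fun h => hne (Subtype.ext h))
    (fun ω z hz => hr ω z hz) (fun ω => ω.2.2)
  rw [Lp.lintegral_fourier_sq_eq_one hi hf1, mul_one] at this
  exact this

end FourierSampling

/-! ### An extremal property of the cosine among functions of exponential type one. -/

namespace FourierSampling

theorem integral_cexp_I_mul {c : ℝ} (hc : c ≠ 0) :
    ∫ s in (-1 : ℝ)..1, Complex.exp (Complex.I * c * s) = 2 * Real.sin c / c := by
  have hc' : (Complex.I * c : ℂ) ≠ 0 := mul_ne_zero Complex.I_ne_zero (by exact_mod_cast hc)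
  have hc2 : (c : ℂ) ≠ 0 := by exact_mod_cast hc
  rw [integral_exp_mul_complex hc', Complex.ofReal_sin, Complex.sin]
  have e1 : Complex.exp (Complex.I * c * (1 : ℝ)) = Complex.exp (c * Complex.I) := by
    congr 1; push_cast; ring
  have e2 : Complex.exp (Complex.I * c * (-1 : ℝ)) = Complex.exp (-c * Complex.I) := by
    congr 1; push_cast; ring
  rw [e1, e2, div_eq_div_iff hc' hc2]
  linear_combination
    (c * (Complex.exp (c * Complex.I) - Complex.exp (-c * Complex.I))) * Complex.I_sq

/-- The coefficients of the interpolation formula for functions of exponential type one with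
nodes at the multiples of `π` and a double node at the origin. -/
def interpCoeff (t : ℝ) (k : ℤ) : ℝ :=
  if k = 0 then Real.sin t / t
  else Real.cos (k * Real.pi) * (Real.sin t * t) / (k * Real.pi * (t - k * Real.pi))

theorem abs_interpCoeff_le {t : ℝ} (h0 : 0 < t) (hπ : t < Real.pi) (k : ℤ) (hk : k ≠ 0) :
    |interpCoeff t k| ≤ t / (Real.pi * (Real.pi - t)) * (1 / (k : ℝ) ^ 2) := by
  rw [interpCoeff, if_neg hk, abs_div, abs_mul, abs_mul, abs_mul, abs_mul, abs_of_pos h0,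
    abs_of_pos Real.pi_pos]
  have hk1 : (1 : ℝ) ≤ |(k : ℝ)| := by
    rw [← Int.cast_abs]; exact_mod_cast Int.one_le_abs hk
  have h1 : |(k : ℝ)| * (Real.pi - t) ≤ |t - k * Real.pi| := by
    have : |(k : ℝ) * Real.pi| - |t| ≤ |t - k * Real.pi| := by
      rw [abs_sub_comm]; exact abs_sub_abs_le_abs_sub _ _
    rw [abs_mul, abs_of_pos Real.pi_pos, abs_of_pos h0] at this
    nlinarith
  have h2 : |Real.cos (k * Real.pi)| * (|Real.sin t| * t) ≤ t := by
    have a1 := Real.abs_cos_le_one (k * Real.pi)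
    have a2 := Real.abs_sin_le_one t
    have a3 : |Real.sin t| * t ≤ t := by nlinarith
    have a4 : 0 ≤ |Real.sin t| * t := by positivity
    nlinarith
  have hpos : 0 < |(k : ℝ)| * Real.pi * (|(k : ℝ)| * (Real.pi - t)) := by
    have := Real.pi_pos
    have : 0 < Real.pi - t := by linarith
    positivity
  calc _ ≤ t / (|(k : ℝ)| * Real.pi * |t - k * Real.pi|) := by gcongr
    _ ≤ t / (|(k : ℝ)| * Real.pi * (|(k : ℝ)| * (Real.pi - t))) := by gcongr
    _ = _ := by
      have hs : (k : ℝ) ^ 2 = |(k : ℝ)| ^ 2 := (sq_abs _).symm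
      rw [hs]
      have : Real.pi - t ≠ 0 := by linarith
      field_simp

theorem summable_interpCoeff {t : ℝ} (h0 : 0 < t) (hπ : t < Real.pi) :
    Summable fun k => |interpCoeff t k| := by
  have hs : Summable fun k : ℤ => t / (Real.pi * (Real.pi - t)) * (1 / (k : ℝ) ^ 2) :=
    (Real.summable_one_div_int_pow.2 (by norm_num)).mul_left _
  refine Summable.of_norm_bounded_eventually hs ?_
  rw [Int.cofinite_eq]
  have h1 : ∀ᶠ k : ℤ in Filter.cofinite, k ≠ 0 := by
    simpa using (Set.finite_singleton (0 : ℤ)).compl_mem_cofinite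
  rw [Int.cofinite_eq] at h1
  filter_upwards [h1] with k hk
  rw [Real.norm_eq_abs, abs_abs]
  exact abs_interpCoeff_le h0 hπ k hk

/-- For `0 < t < π` and `k ≠ 0` the product `kπ(t - kπ)` is negative. This alternation of signs is
what makes the cosine extremal in `mul_cos_le_re_integral_cexp`. -/
theorem interpCoeff_mul_cos_nonpos {t : ℝ} (h0 : 0 < t) (hπ : t < Real.pi) {k : ℤ} (hk : k ≠ 0) :
    interpCoeff t k * Real.cos (k * Real.pi) ≤ 0 := by
  rw [interpCoeff, if_neg hk]
  have hs : 0 < Real.sin t := Real.sin_pos_of_pos_of_lt_pi h0 hπ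
  have h1 : (k : ℝ) * Real.pi * (t - k * Real.pi) < 0 := by
    rcases lt_or_gt_of_ne hk with h | h
    · have : (k : ℝ) < 0 := by exact_mod_cast h
      nlinarith [Real.pi_pos, mul_neg_of_neg_of_pos this Real.pi_pos]
    · have : (1 : ℝ) ≤ k := by exact_mod_cast h
      have h2 : 0 < (k : ℝ) * Real.pi := by positivity
      have h3 : Real.pi ≤ k * Real.pi := by nlinarith [Real.pi_pos]
      nlinarith
  rw [mul_comm, ← mul_div_assoc, ← mul_assoc]
  refine div_nonpos_of_nonneg_of_nonpos ?_ h1.le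
  have := mul_self_nonneg (Real.cos (k * Real.pi))
  positivity

/-- The linear term `i sin t · s` is chosen so that the values at `-1` and `1` agree. The periodic
extension is then continuous, and integration by parts leaves no boundary term, whence the quadratic
decay of the coefficients. -/
theorem interp_aux_periodic (t : ℝ) :
    Complex.exp (Complex.I * t * ((-1 : ℝ) : ℂ)) - Complex.I * Real.sin t * ((-1 : ℝ) : ℂ)
      = Complex.exp (Complex.I * t * ((-1 + 2 : ℝ) : ℂ))
        - Complex.I * Real.sin t * ((-1 + 2 : ℝ) : ℂ) := by
  have e1 : Complex.exp (Complex.I * t * ((-1 : ℝ) : ℂ)) = Complex.exp (((-t : ℝ) : ℂ) * Complex.I) := by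
    congr 1; push_cast; ring
  have e2 : Complex.exp (Complex.I * t * ((-1 + 2 : ℝ) : ℂ)) = Complex.exp (t * Complex.I) := by
    congr 1; push_cast; ring
  rw [e1, e2, Complex.exp_mul_I, Complex.exp_mul_I, ← Complex.ofReal_cos, ← Complex.ofReal_sin,
    ← Complex.ofReal_cos, ← Complex.ofReal_sin, Real.cos_neg, Real.sin_neg]
  push_cast
  ring

/-- For `n ≠ 0` one integrates by parts: the constant in the derivative has zero coefficient and the
exponential gives a sine quotient. The endpoint is written `-1 + 2` to match the period of the
circle in `hasSum_interpCoeff`. -/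
theorem fourierCoeffOn_interp {t : ℝ} (h0 : 0 < t) (hπ : t < Real.pi) (n : ℤ)
    (hab : (-1 : ℝ) < -1 + 2) :
    fourierCoeffOn hab
      (fun s : ℝ => Complex.exp (Complex.I * t * s) - Complex.I * Real.sin t * s) n
      = interpCoeff t n := by
  have htn : t - n * Real.pi ≠ 0 := by
    intro h
    have h1 : (n : ℝ) * Real.pi = t := by linarith
    have h2 : (0 : ℝ) < n := by
      by_contra hn; nlinarith [Real.pi_pos]
    have h3 : (n : ℝ) < 1 := by
      by_contra hn; nlinarith [Real.pi_pos]
    have h4 : (0 : ℤ) < n := by exact_mod_cast h2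
    have h5 : n < (1 : ℤ) := by exact_mod_cast h3
    omega
  have hsin : Real.sin (t - n * Real.pi) = Real.cos (n * Real.pi) * Real.sin t := by
    rw [Real.sin_sub, Real.sin_int_mul_pi]; ring
  have hone : ∀ x : ℝ, fourier (-n) (x : AddCircle ((-1 + 2 : ℝ) - (-1)))
      = Complex.exp (Complex.I * ((-(n * Real.pi) : ℝ) : ℂ) * x) := by
    intro x
    rw [fourier_coe_apply]
    congr 1
    push_cast
    ring
  have hE : ∀ x : ℝ, Complex.exp (Complex.I * ((-(n * Real.pi) : ℝ) : ℂ) * x) *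
      Complex.exp (Complex.I * t * x) = Complex.exp (Complex.I * ((t - n * Real.pi : ℝ) : ℂ) * x) := by
    intro x
    rw [← Complex.exp_add]; congr 1; push_cast; ring
  have hi : ∀ c : ℝ, IntervalIntegrable (fun s : ℝ => Complex.exp (Complex.I * (c : ℂ) * s))
      volume (-1) 1 := fun c => by
    apply Continuous.intervalIntegrable; fun_prop
  by_cases hn : n = 0
  · subst hn
    rw [fourierCoeffOn_eq_integral, interpCoeff, if_pos rfl]
    have e : ∀ x : ℝ, (fourier (-(0 : ℤ)) (x : AddCircle ((-1 + 2 : ℝ) - (-1)))) •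
        (Complex.exp (Complex.I * t * x) - Complex.I * Real.sin t * x)
        = Complex.exp (Complex.I * t * x) - Complex.I * Real.sin t * x := by
      intro x; simp
    simp only [e]
    rw [show (-1 + 2 : ℝ) = 1 by norm_num, intervalIntegral.integral_sub (hi t)
      (by apply Continuous.intervalIntegrable; fun_prop), integral_cexp_I_mul h0.ne',
      intervalIntegral.integral_const_mul, intervalIntegral.integral_ofReal, integral_id]
    rw [Complex.real_smul]
    push_cast
    have : (t : ℂ) ≠ 0 := by exact_mod_cast h0.ne'
    field_simp
    norm_num
    ring
  · have hnR : (n : ℝ) ≠ 0 := by exact_mod_cast hn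
    have hd : ∀ x : ℝ, HasDerivAt
        (fun s : ℝ => Complex.exp (Complex.I * t * s) - Complex.I * Real.sin t * s)
        (Complex.I * t * Complex.exp (Complex.I * t * x) - Complex.I * Real.sin t) x := by
      intro x
      have h1 : HasDerivAt (fun s : ℝ => (s : ℂ)) 1 x := Complex.ofRealCLM.hasDerivAt
      have h2 := ((h1.const_mul (Complex.I * t)).cexp).sub (h1.const_mul (Complex.I * Real.sin t))
      refine h2.congr_deriv ?_
      ring
    rw [fourierCoeffOn_of_hasDerivAt hab hn (fun x _ => hd x)
      (by apply Continuous.intervalIntegrable; fun_prop), ← interp_aux_periodic, sub_self, mul_zero,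
      fourierCoeffOn_eq_integral]
    simp only [hone, smul_eq_mul, mul_sub]
    have e : ∀ x : ℝ, Complex.exp (Complex.I * ((-(n * Real.pi) : ℝ) : ℂ) * x) *
        (Complex.I * t * Complex.exp (Complex.I * t * x))
        = Complex.I * t * Complex.exp (Complex.I * ((t - n * Real.pi : ℝ) : ℂ) * x) := by
      intro x; rw [← hE]; ring
    simp only [e]
    have hnpi : -((n : ℝ) * Real.pi) ≠ 0 := neg_ne_zero.2 (mul_ne_zero hnR Real.pi_ne_zero)
    rw [show (-1 + 2 : ℝ) = 1 by norm_num, intervalIntegral.integral_sub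
      ((hi _).const_mul _) ((hi _).mul_const _), intervalIntegral.integral_const_mul,
      intervalIntegral.integral_mul_const, integral_cexp_I_mul htn, integral_cexp_I_mul hnpi,
      Real.sin_neg, Real.sin_int_mul_pi, hsin, interpCoeff, if_neg hn, Complex.real_smul]
    push_cast
    have h1 : (t : ℂ) - n * Real.pi ≠ 0 := by exact_mod_cast htn
    have h2 : (n : ℂ) ≠ 0 := by exact_mod_cast hn
    have h3 : (Real.pi : ℂ) ≠ 0 := by exact_mod_cast Real.pi_ne_zero
    have h4 := Complex.I_ne_zero
    field_simp
    ring

/-- The interpolation formula for the exponentials of type at most one. -/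
theorem hasSum_interpCoeff {t : ℝ} (h0 : 0 < t) (hπ : t < Real.pi) {s : ℝ} (hs : |s| ≤ 1) :
    HasSum (fun k : ℤ => (interpCoeff t k : ℂ) * Complex.exp (Complex.I * (k * Real.pi * s : ℝ)))
      (Complex.exp (Complex.I * t * s) - Complex.I * Real.sin t * s) := by
  have : Fact ((0 : ℝ) < 2) := ⟨by norm_num⟩
  set P : ℝ → ℂ := fun s => Complex.exp (Complex.I * t * s) - Complex.I * Real.sin t * s with hP
  have hper : P (-1) = P (-1 + 2) := interp_aux_periodic t
  let f : C(AddCircle (2 : ℝ), ℂ) := ⟨AddCircle.liftIco 2 (-1) P,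
    AddCircle.liftIco_continuous hper (by
      apply Continuous.continuousOn; rw [hP]; fun_prop)⟩
  have hcoeff : ∀ n, fourierCoeff f n = interpCoeff t n := fun n => by
    have := fourierCoeff_liftIco_eq (T := 2) (a := -1) P n
    rw [hP, fourierCoeffOn_interp h0 hπ] at this
    exact this
  have hsum : Summable (fourierCoeff f) := by
    refine Summable.of_norm ?_
    simp only [hcoeff, Complex.norm_real, Real.norm_eq_abs]
    exact summable_interpCoeff h0 hπ
  have key := has_pointwise_sum_fourier_series_of_summable hsum (s : AddCircle (2 : ℝ))
  have hval : f (s : AddCircle (2 : ℝ)) = P s := by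
    change AddCircle.liftIco 2 (-1) P (s : AddCircle (2 : ℝ)) = P s
    obtain ⟨h1, h2⟩ := abs_le.1 hs
    rcases h2.lt_or_eq with h | h
    · exact AddCircle.liftIco_coe_apply ⟨h1, by linarith⟩
    -- The point `s = 1` lies outside the half-open fundamental interval and is identified with
    -- `-1`.
    · have e : (s : AddCircle (2 : ℝ)) = ((-1 : ℝ) : AddCircle (2 : ℝ)) := by
        rw [h, ← AddCircle.coe_add_period 2 (-1 : ℝ)]; norm_num
      rw [e, AddCircle.liftIco_coe_apply ⟨le_rfl, by norm_num⟩, hper, h]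
      norm_num
  rw [hval] at key
  convert key using 2 with k
  rw [hcoeff, smul_eq_mul, fourier_coe_apply]
  congr 2
  push_cast
  ring

theorem hasDerivAt_integral_cexp {α : Type*} [MeasurableSpace α] {μ : Measure α} {a : α → ℂ}
    (ha : Integrable a μ) {s : α → ℝ} (hs : AEMeasurable s μ) (hs1 : ∀ x, |s x| ≤ 1) :
    HasDerivAt (fun τ : ℝ => ∫ x, a x * Complex.exp (Complex.I * τ * s x) ∂μ)
      (∫ x, a x * (Complex.I * s x) ∂μ) 0 := by
  have hsm : AEStronglyMeasurable (fun x => (s x : ℂ)) μ :=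
    (Complex.measurable_ofReal.comp_aemeasurable hs).aestronglyMeasurable
  have hem : ∀ τ : ℝ, AEStronglyMeasurable (fun x => Complex.exp (Complex.I * τ * s x)) μ :=
    fun τ => Complex.continuous_exp.comp_aestronglyMeasurable (hsm.const_mul _)
  have hen : ∀ (τ : ℝ) x, ‖Complex.exp (Complex.I * τ * s x)‖ = 1 := fun τ x => by
    rw [show Complex.I * τ * s x = ((τ * s x : ℝ) : ℂ) * Complex.I by push_cast; ring,
      Complex.norm_exp_ofReal_mul_I]
  have := (hasDerivAt_integral_of_dominated_loc_of_deriv_le (μ := μ) (s := Set.univ) (x₀ := (0 : ℝ))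
    (F := fun (τ : ℝ) x => a x * Complex.exp (Complex.I * τ * s x))
    (F' := fun (τ : ℝ) x => a x * (Complex.exp (Complex.I * τ * s x) * (Complex.I * s x)))
    (bound := fun x => ‖a x‖) Filter.univ_mem
    (Filter.Eventually.of_forall fun τ => ha.aestronglyMeasurable.mul (hem τ))
    (by simpa using ha)
    (ha.aestronglyMeasurable.mul ((hem 0).mul (hsm.const_mul _))) ?_ ha.norm ?_).2
  · simpa using this
  · refine Filter.Eventually.of_forall fun x τ _ => ?_
    rw [norm_mul, norm_mul, hen, one_mul, norm_mul, Complex.norm_I, one_mul, Complex.norm_real]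
    exact mul_le_of_le_one_right (norm_nonneg _) (hs1 x)
  · refine Filter.Eventually.of_forall fun x τ _ => ?_
    have h1 : HasDerivAt (fun s : ℝ => (s : ℂ)) 1 τ := Complex.ofRealCLM.hasDerivAt
    have h2 := (((h1.const_mul Complex.I).mul_const (s x : ℂ)).cexp).const_mul (a x)
    refine h2.congr_deriv ?_
    ring

/-- A function of exponential type at most one whose modulus is maximal at the origin, where it is
positive, dominates the cosine on `(0, π)`. -/
theorem mul_cos_le_re_integral_cexp {α : Type*} [MeasurableSpace α] {μ : Measure α} {a : α → ℂ}
    (ha : Integrable a μ) {s : α → ℝ} (hs : AEMeasurable s μ) (hs1 : ∀ x, |s x| ≤ 1)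
    {A : ℝ} (hA : ∫ x, a x ∂μ = A)
    (hmax : ∀ τ : ℝ, ‖∫ x, a x * Complex.exp (Complex.I * τ * s x) ∂μ‖ ≤ A)
    {t : ℝ} (h0 : 0 < t) (hπ : t < Real.pi) :
    A * Real.cos t ≤ (∫ x, a x * Complex.exp (Complex.I * t * s x) ∂μ).re := by
  set H : ℝ → ℂ := fun τ => ∫ x, a x * Complex.exp (Complex.I * τ * s x) ∂μ with hH
  have hsm : AEStronglyMeasurable (fun x => (s x : ℂ)) μ :=
    (Complex.measurable_ofReal.comp_aemeasurable hs).aestronglyMeasurable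
  have hH0 : H 0 = A := by simpa [hH] using hA
  have hen : ∀ (τ : ℝ) x, ‖Complex.exp (Complex.I * τ * s x)‖ = 1 := fun τ x => by
    rw [show Complex.I * τ * s x = ((τ * s x : ℝ) : ℂ) * Complex.I by push_cast; ring,
      Complex.norm_exp_ofReal_mul_I]
  have hint : ∀ τ : ℝ, Integrable (fun x => a x * Complex.exp (Complex.I * τ * s x)) μ := fun τ => by
    refine ha.mul_bdd (c := 1) (Complex.continuous_exp.comp_aestronglyMeasurable
      (hsm.const_mul _)) (Filter.Eventually.of_forall fun x => (hen τ x).le)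
  have hint' : Integrable (fun x => a x * (Complex.I * s x)) μ := by
    refine ha.mul_bdd (c := 1) (hsm.const_mul _) (Filter.Eventually.of_forall fun x => ?_)
    rw [norm_mul, Complex.norm_I, one_mul, Complex.norm_real]
    exact hs1 x
  -- the derivative of the real part vanishes at the origin
  have hderiv := hasDerivAt_integral_cexp ha hs hs1
  set H' : ℂ := ∫ x, a x * (Complex.I * s x) ∂μ with hH'
  have hre : H'.re = 0 := by
    have hd : HasDerivAt (fun τ : ℝ => (H τ).re) H'.re 0 :=
      Complex.reCLM.hasFDerivAt.comp_hasDerivAt (0 : ℝ) hderiv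
    refine IsLocalMax.hasDerivAt_eq_zero (Filter.Eventually.of_forall fun τ => ?_) hd
    simp only [hH0, Complex.ofReal_re]
    exact (Complex.re_le_norm _).trans (hmax τ)
  -- the interpolation formula
  have hsumm := summable_interpCoeff h0 hπ
  have hint3 : ∀ k : ℤ, Integrable (fun x => a x * ((interpCoeff t k : ℂ) *
      Complex.exp (Complex.I * (k * Real.pi * s x : ℝ)))) μ := fun k => by
    have := (hint (k * Real.pi)).const_mul (interpCoeff t k : ℂ)
    refine this.congr (Filter.Eventually.of_forall fun x => ?_)
    simp only
    push_cast
    ring_nf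
  have hterm : ∀ k : ℤ, ∫ x, a x * ((interpCoeff t k : ℂ) *
      Complex.exp (Complex.I * (k * Real.pi * s x : ℝ))) ∂μ = interpCoeff t k * H (k * Real.pi) := by
    intro k
    rw [hH, ← integral_const_mul]
    congr 1 with x
    push_cast
    ring_nf
  have hS := hasSum_integral_of_summable_integral_norm hint3 (by
    have e : ∀ k : ℤ, ∫ x, ‖a x * ((interpCoeff t k : ℂ) *
        Complex.exp (Complex.I * (k * Real.pi * s x : ℝ)))‖ ∂μ
        = |interpCoeff t k| * ∫ x, ‖a x‖ ∂μ := by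
      intro k
      rw [← integral_const_mul]
      congr 1 with x
      rw [norm_mul, norm_mul, mul_comm Complex.I, Complex.norm_exp_ofReal_mul_I, mul_one,
        Complex.norm_real, Real.norm_eq_abs, mul_comm]
    simp only [e]
    exact hsumm.mul_right _)
  simp only [hterm] at hS
  have hrhs : ∫ x, ∑' k : ℤ, a x * ((interpCoeff t k : ℂ) *
      Complex.exp (Complex.I * (k * Real.pi * s x : ℝ))) ∂μ = H t - Real.sin t * H' := by
    rw [hH, hH', ← integral_const_mul, ← integral_sub (hint t) (hint'.const_mul _)]
    congr 1 with x
    rw [((hasSum_interpCoeff h0 hπ (hs1 x)).mul_left (a x)).tsum_eq]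
    ring
  rw [hrhs] at hS
  have hSre := Complex.hasSum_re hS
  -- The comparison function `cos t` satisfies the same formula: take `s = 1` and real parts, where
  -- the linear term is purely imaginary.
  have hcosS : HasSum (fun k : ℤ => interpCoeff t k * Real.cos (k * Real.pi)) (Real.cos t) := by
    have := Complex.hasSum_re (hasSum_interpCoeff h0 hπ (s := 1) (by simp))
    convert this using 1
    · ext k
      rw [Complex.re_ofReal_mul, mul_comm Complex.I, Complex.exp_ofReal_mul_I_re, mul_one]
    · rw [show Complex.I * t * ((1 : ℝ) : ℂ) = t * Complex.I by push_cast; ring, Complex.sub_re,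
        Complex.exp_ofReal_mul_I_re]
      simp
  -- Since `cos(kπ)² = 1`, the difference is the sum of `c_k cos(kπ) (Re H(kπ) cos(kπ) - A)`. For `k
  -- ≠ 0` both factors `c_k cos(kπ)` and the bracket are nonpositive, and the term `k = 0` vanishes
  -- because `H 0 = A`.
  have hdiff := hSre.sub (hcosS.mul_left A)
  have hnn := hdiff.nonneg fun k => by
    rw [Complex.re_ofReal_mul]
    by_cases hk : k = 0
    · subst hk
      simp [hH0]; linarith
    · have h1 := interpCoeff_mul_cos_nonpos h0 hπ hk
      have h2 : (H (k * Real.pi)).re * Real.cos (k * Real.pi) ≤ A := by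
        have h3 : |(H (k * Real.pi)).re| ≤ A := (Complex.abs_re_le_norm _).trans (hmax _)
        have h4 := Real.abs_cos_le_one (k * Real.pi)
        calc _ ≤ |(H (k * Real.pi)).re * Real.cos (k * Real.pi)| := le_abs_self _
          _ = |(H (k * Real.pi)).re| * |Real.cos (k * Real.pi)| := abs_mul _ _
          _ ≤ A * 1 := by
            gcongr
            exact (abs_nonneg _).trans h3
          _ = A := mul_one A
      have h5 : Real.cos (k * Real.pi) * Real.cos (k * Real.pi) = 1 := by
        have := Real.sin_sq_add_cos_sq (k * Real.pi)
        rw [Real.sin_int_mul_pi] at this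
        nlinarith
      have h6 : interpCoeff t k * (H (k * Real.pi)).re
          = interpCoeff t k * Real.cos (k * Real.pi)
            * ((H (k * Real.pi)).re * Real.cos (k * Real.pi)) := by
        linear_combination (-interpCoeff t k * (H (k * Real.pi)).re) * h5
      nlinarith
  have : (H t - Real.sin t * H').re = (H t).re := by
    rw [Complex.sub_re, Complex.re_ofReal_mul, hre]; ring
  rw [this] at hnn
  linarith

/-- A function of exponential type at most one whose modulus is maximal at the origin cannot decay
faster than the cosine. -/
theorem norm_mul_cos_le_norm_integral_cexp {α : Type*} [MeasurableSpace α] {μ : Measure α}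
    {a : α → ℂ} (ha : Integrable a μ) {s : α → ℝ} (hs : AEMeasurable s μ)
    (hs1 : ∀ᵐ x ∂μ, a x ≠ 0 → |s x| ≤ 1)
    (hmax : ∀ τ : ℝ, ‖∫ x, a x * Complex.exp (Complex.I * τ * s x) ∂μ‖ ≤ ‖∫ x, a x ∂μ‖)
    {t : ℝ} (h0 : 0 < t) (hπ : t < Real.pi) :
    ‖∫ x, a x ∂μ‖ * Real.cos t ≤ ‖∫ x, a x * Complex.exp (Complex.I * t * s x) ∂μ‖ := by
  set z := ∫ x, a x ∂μ with hz
  by_cases hz0 : z = 0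
  · rw [hz0]; simp
  have hzn : (‖z‖ : ℂ) ≠ 0 := by simpa using hz0
  -- Multiplication by this unimodular number makes the value at the origin positive.
  set u : ℂ := (starRingEnd ℂ) z / ‖z‖ with hu
  have hun : ‖u‖ = 1 := by
    rw [hu, norm_div, RCLike.norm_conj, Complex.norm_real, norm_norm]
    exact div_self (norm_ne_zero_iff.2 hz0)
  -- Truncating the phase to `[-1, 1]` changes it only where `a` vanishes, up to a null set. The
  -- previous inequality needs the bound at every point.
  set s' : α → ℝ := fun x => max (-1) (min 1 (s x)) with hs'
  have hs'm : AEMeasurable s' μ := (aemeasurable_const (b := (-1 : ℝ))).max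
    ((aemeasurable_const (b := (1 : ℝ))).min hs)
  have hs'1 : ∀ x, |s' x| ≤ 1 := fun x =>
    abs_le.2 ⟨le_max_left _ _, max_le (by norm_num) (min_le_left _ _)⟩
  have heq : ∀ τ : ℝ, ∫ x, u * a x * Complex.exp (Complex.I * τ * s' x) ∂μ
      = u * ∫ x, a x * Complex.exp (Complex.I * τ * s x) ∂μ := by
    intro τ
    rw [← integral_const_mul]
    apply integral_congr_ae
    filter_upwards [hs1] with x hx
    by_cases hax : a x = 0
    · simp [hax]
    · obtain ⟨h1, h2⟩ := abs_le.1 (hx hax)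
      have : s' x = s x := by
        simp only [hs', min_eq_right h2, max_eq_right h1]
      rw [this, mul_assoc]
  have key := mul_cos_le_re_integral_cexp (ha.const_mul u) hs'm hs'1 (A := ‖z‖) (by
      rw [integral_const_mul, ← hz, hu, div_mul_eq_mul_div, mul_comm, Complex.mul_conj,
        Complex.normSq_eq_norm_sq, Complex.ofReal_pow, sq, mul_div_assoc, div_self hzn, mul_one])
    (fun τ => by rw [heq, norm_mul, hun, one_mul]; exact hmax τ) h0 hπ
  refine key.trans ((Complex.re_le_norm _).trans ?_)
  rw [heq, norm_mul, hun, one_mul]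

end FourierSampling

/-! ### The lower estimate for sets of gap less than `1/4`. -/

namespace FourierSampling

section DenseSampling

variable {d : ℕ} {D : Set (Space d)}

/-- Along a ray, the product of two Fourier transforms is a one-dimensional exponential integral. -/
theorem fourier_mul_fourier_ray {f ψ : Space d → ℂ} (ξ x₀ u : Space d) (τ : ℝ) {σ : ℝ} (hσ : σ ≠ 0) :
    𝓕 f (x₀ + τ • u) * 𝓕 ψ (ξ - (x₀ + τ • u)) =
      ∫ q : Space d × Space d, (f q.1 * Complex.exp ((-2 * Real.pi * inner ℝ q.1 x₀ : ℝ) * Complex.I)) *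
          (ψ q.2 * Complex.exp ((-2 * Real.pi * inner ℝ q.2 (ξ - x₀) : ℝ) * Complex.I)) *
        Complex.exp (Complex.I * (τ * σ : ℝ) *
          (2 * Real.pi * (inner ℝ q.2 u - inner ℝ q.1 u) / σ : ℝ)) ∂(volume.prod volume) := by
  rw [Real.fourier_eq', Real.fourier_eq', ← integral_prod_mul]
  congr 1 with q
  simp only [smul_eq_mul]
  have e1 : Complex.exp ((-2 * Real.pi * inner ℝ q.1 (x₀ + τ • u) : ℝ) * Complex.I) *
      Complex.exp ((-2 * Real.pi * inner ℝ q.2 (ξ - (x₀ + τ • u)) : ℝ) * Complex.I)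
      = Complex.exp ((-2 * Real.pi * inner ℝ q.1 x₀ : ℝ) * Complex.I) *
        Complex.exp ((-2 * Real.pi * inner ℝ q.2 (ξ - x₀) : ℝ) * Complex.I) *
        Complex.exp (Complex.I * (τ * σ : ℝ) *
          (2 * Real.pi * (inner ℝ q.2 u - inner ℝ q.1 u) / σ : ℝ)) := by
    rw [← Complex.exp_add, ← Complex.exp_add, ← Complex.exp_add]
    congr 1
    rw [← sub_sub, inner_add_right, inner_sub_right _ (ξ - x₀), inner_smul_right, inner_smul_right,
      mul_assoc Complex.I, ← Complex.ofReal_mul]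
    rw [show τ * σ * (2 * Real.pi * (inner ℝ q.2 u - inner ℝ q.1 u) / σ)
      = τ * (2 * Real.pi * (inner ℝ q.2 u - inner ℝ q.1 u)) by field_simp]
    push_cast
    ring
  linear_combination (f q.1 * ψ q.2) * e1

/-- A localized Fourier transform of a function supported on `D` cannot decay too fast from its
maximum. -/
theorem norm_fourier_mul_cos_le (hD : IsCenteredSymmConvexBody D) {f ψ : Space d → ℂ}
    (hf : Integrable f) (hfD : ∀ᵐ x, x ∉ D → f x = 0) (hψ : Integrable ψ) {r : ℝ}
    (hψr : ∀ y, r < ‖y‖ → ψ y = 0) {ρ₀ ρ : ℝ} (hρ0 : 0 < ρ) (hρ : ρ < 1 / 2)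
    {ξ x₀ u : Space d} (hu : gauge (polarSet D) u ≤ ρ₀) (hru : r * ‖u‖ ≤ ρ - ρ₀)
    (hmax : ∀ ζ, ‖𝓕 f ζ * 𝓕 ψ (ξ - ζ)‖ ≤ ‖𝓕 f x₀ * 𝓕 ψ (ξ - x₀)‖) :
    ‖𝓕 f x₀ * 𝓕 ψ (ξ - x₀)‖ * Real.cos (2 * Real.pi * ρ) ≤
      ‖𝓕 f (x₀ + u) * 𝓕 ψ (ξ - (x₀ + u))‖ := by
  have hπ := Real.pi_pos
  -- Along `x₀ + τ • u` the angular frequencies are `2π(⟨y, u⟩ - ⟨x, u⟩)` with `x ∈ D` and `‖y‖ ≤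
  -- r`. The inner products are bounded by `ρ₀` and `ρ - ρ₀`, so dividing by `σ` gives type one. The
  -- endpoint `x₀ + u` becomes the parameter `σ`, which is less than `π` because `ρ < 1/2`.
  set σ : ℝ := 2 * Real.pi * ρ with hσ
  have hσ0 : 0 < σ := by positivity
  have hray := fun τ : ℝ => fourier_mul_fourier_ray (f := f) (ψ := ψ) ξ x₀ u τ hσ0.ne'
  set a : Space d × Space d → ℂ := fun q =>
    (f q.1 * Complex.exp ((-2 * Real.pi * inner ℝ q.1 x₀ : ℝ) * Complex.I)) *
          (ψ q.2 * Complex.exp ((-2 * Real.pi * inner ℝ q.2 (ξ - x₀) : ℝ) * Complex.I)) with ha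
  set s : Space d × Space d → ℝ := fun q =>
    2 * Real.pi * (inner ℝ q.2 u - inner ℝ q.1 u) / σ with hs
  have hexp : ∀ {g : Space d → ℂ}, Integrable g → ∀ v : Space d, Integrable
      (fun x => g x * Complex.exp ((-2 * Real.pi * inner ℝ x v : ℝ) * Complex.I)) := by
    intro g hg v
    refine hg.mul_bdd (c := 1) ?_ (Filter.Eventually.of_forall fun x => ?_)
    · apply Continuous.aestronglyMeasurable
      fun_prop
    · rw [Complex.norm_exp_ofReal_mul_I]
  have hai : Integrable a (volume.prod volume) := (hexp hf x₀).mul_prod (hexp hψ (ξ - x₀))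
  have hsm : AEMeasurable s (volume.prod volume) := by
    apply Continuous.aemeasurable
    rw [hs]
    fun_prop
  have hs1 : ∀ᵐ q ∂(volume.prod volume), a q ≠ 0 → |s q| ≤ 1 := by
    have h1 : ∀ᵐ q : Space d × Space d ∂(volume.prod volume), q.1 ∉ D → f q.1 = 0 :=
      Measure.quasiMeasurePreserving_fst.ae hfD
    filter_upwards [h1] with q hq haq
    have hq1 : q.1 ∈ D := by
      by_contra h
      exact haq (by simp [ha, hq h])
    have hq2 : ‖q.2‖ ≤ r := by
      by_contra h
      exact haq (by simp [ha, hψr _ (not_le.1 h)])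
    have i1 := inner_le_gauge_polarSet (y := u) hD hq1
    have i2 := inner_le_gauge_polarSet (y := u) hD (hD.symm _ hq1)
    rw [inner_neg_left] at i2
    have i3 : |inner ℝ q.2 u| ≤ ρ - ρ₀ :=
      (abs_real_inner_le_norm _ _).trans ((by gcongr : ‖q.2‖ * ‖u‖ ≤ r * ‖u‖).trans hru)
    obtain ⟨i4, i5⟩ := abs_le.1 i3
    have i6 : |inner ℝ q.2 u - inner ℝ q.1 u| ≤ ρ := by
      rw [abs_le]; constructor <;> linarith
    rw [hs]
    simp only
    rw [abs_div, abs_of_pos hσ0, div_le_one hσ0, abs_mul, abs_of_pos (by positivity), hσ]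
    gcongr
  have h0 : 𝓕 f x₀ * 𝓕 ψ (ξ - x₀) = ∫ q, a q ∂(volume.prod volume) := by
    have := hray 0
    simp only [zero_smul, add_zero, zero_mul, Complex.ofReal_zero, mul_zero, Complex.exp_zero,
      mul_one] at this
    exact this
  have h1 : 𝓕 f (x₀ + u) * 𝓕 ψ (ξ - (x₀ + u))
      = ∫ q, a q * Complex.exp (Complex.I * σ * s q) ∂(volume.prod volume) := by
    have := hray 1
    simp only [one_smul, one_mul] at this
    exact this
  have hm : ∀ τ : ℝ, ‖∫ q, a q * Complex.exp (Complex.I * τ * s q) ∂(volume.prod volume)‖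
      ≤ ‖∫ q, a q ∂(volume.prod volume)‖ := by
    intro τ
    have := hray (τ / σ)
    rw [div_mul_cancel₀ _ hσ0.ne'] at this
    rw [← this, ← h0]
    exact hmax _
  rw [h0, h1]
  exact norm_mul_cos_le_norm_integral_cexp hai hsm hs1 hm hσ0 (by rw [hσ]; nlinarith)

theorem norm_fourier_le {f : Space d → ℂ} (ξ : Space d) : ‖𝓕 f ξ‖ ≤ ∫ x, ‖f x‖ :=
  VectorFourier.norm_fourierIntegral_le_integral_norm _ _ _ _ _

/-- Pointwise bound for a Fourier transform by its samples on a set of small gap. -/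
theorem exists_enorm_fourier_sq_le_tsum (hD : IsCenteredSymmConvexBody D) {Ω : Set (Space d)}
    (hΩ_countable : Ω.Countable) (hgap : gap (polarSet D) Ω < 1 / 4) :
    ∃ C : ℝ, 0 < C ∧ ∀ f : Space d → ℂ, Integrable f → (∀ᵐ x, x ∉ D → f x = 0) →
      ∀ W : Ω → Set (Space d), (∀ ω : Ω, W ω ⊆ voronoiRegion (polarSet D) Ω ω) →
        (⋃ ω, W ω) = Set.univ → ∀ ξ, ‖𝓕 f ξ‖ₑ ^ 2 ≤
          ENNReal.ofReal C * ∑' ω : Ω, volume (W ω) * ‖𝓕 f ω‖ₑ ^ 2 * decayKernel d (ξ - ω) := by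
  have hcount : Countable Ω := hΩ_countable.to_subtype
  obtain ⟨r₀, hr₀, hr₀D⟩ := hD.exists_closedBall_subset
  obtain ⟨R, hR, hRD⟩ := hD.exists_norm_le
  have hgt : gap (polarSet D) Ω ≠ ⊤ := (hgap.trans (by norm_num)).ne
  set δ := (gap (polarSet D) Ω).toReal with hδ
  have hδ0 : 0 ≤ δ := ENNReal.toReal_nonneg
  have hδ4 : δ < 1 / 4 := by
    have := ENNReal.toReal_strict_mono (by norm_num) hgap
    simpa using this
  -- The slack below `1/4` is cut into three: one `κ` for moving inside the ball around the maximum,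
  -- one for the spectrum added by `ψ`, and one to keep `δ + 2κ < 1/4`, so that the cosine is
  -- positive.
  set κ := (1 / 4 - δ) / 3 with hκ
  have hκ0 : 0 < κ := by rw [hκ]; linarith
  -- The relevant samples satisfy `r₀‖ω - x₀‖ ≤ 1/4`, so this support radius of `ψ` gives `r‖ω - x₀‖
  -- ≤ κ`.
  set r := 4 * r₀ * κ with hr
  have hr0 : 0 < r := by positivity
  let b : ContDiffBump (0 : Space d) := ⟨r / 2, r, by positivity, by linarith⟩
  let ψ : SchwartzMap (Space d) ℂ := HasCompactSupport.toSchwartzMap (f := fun x => (b x : ℂ))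
    (b.hasCompactSupport.comp_left (g := fun x : ℝ => (x : ℂ)) (by simp))
    (Complex.ofRealCLM.contDiff.comp b.contDiff)
  have hψb : ∀ y, ψ y = (b y : ℂ) := fun y => rfl
  have hψr : ∀ y, r < ‖y‖ → ψ y = 0 := fun y hy => by
    rw [hψb, b.zero_of_le_dist]
    · simp
    · rw [dist_zero_right]; exact hy.le
  have hφ0 : 𝓕 (ψ : Space d → ℂ) 0 ≠ 0 := by
    rw [Real.fourier_eq']
    simp only [inner_zero_right, mul_zero, Complex.ofReal_zero, zero_mul, Complex.exp_zero, one_smul,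
      hψb]
    rw [integral_complex_ofReal]
    exact_mod_cast (b.integral_pos (μ := volume)).ne'
  obtain ⟨C₀, hC₀, hdec⟩ := exists_schwartz_le_decayKernel (𝓕 ψ)
  set ε := κ / R with hε
  have hε0 : 0 < ε := by positivity
  set c := Real.cos (2 * Real.pi * (δ + 2 * κ)) with hc
  have hc0 : 0 < c := by
    have := Real.pi_pos
    apply Real.cos_pos_of_mem_Ioo
    constructor
    · have : 0 ≤ 2 * Real.pi * (δ + 2 * κ) := by positivity
      linarith
    · have : δ + 2 * κ < 1 / 4 := by rw [hκ]; linarith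
      nlinarith
  set m := (volume (Metric.ball (0 : Space d) ε)).toReal with hm
  have hm0 : 0 < m := ENNReal.toReal_pos (Metric.measure_ball_pos _ _ hε0).ne' measure_ball_lt_top.ne
  set A := ‖𝓕 (ψ : Space d → ℂ) 0‖ * c with hA
  have hA0 : 0 < A := mul_pos (norm_pos_iff.2 hφ0) hc0
  refine ⟨C₀ ^ 2 / (A ^ 2 * m), by positivity, fun f hf hfD W hW hWu ξ => ?_⟩
  set G : Space d → ℂ := fun ζ => 𝓕 f ζ * 𝓕 (ψ : Space d → ℂ) (ξ - ζ) with hG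
  have hψi : Integrable (ψ : Space d → ℂ) := ψ.integrable
  have hGc : Continuous G := (continuous_fourier hf).mul
    ((continuous_fourier hψi).comp (continuous_const.sub continuous_id))
  -- The maximum exists because `𝓕 f` is bounded and `𝓕 ψ` vanishes at infinity. Its size is at
  -- least `‖𝓕 f ξ‖ ‖𝓕 ψ 0‖`, the value of `‖G‖` at `ξ`.
  obtain ⟨x₀, hx₀⟩ : ∃ x₀, ∀ ζ, ‖G ζ‖ ≤ ‖G x₀‖ := by
    by_cases hz : ∀ ζ, G ζ = 0
    · exact ⟨0, fun ζ => by rw [hz, hz]⟩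
    push Not at hz
    obtain ⟨ζ₀, hζ₀⟩ := hz
    refine hGc.norm.exists_forall_ge' ζ₀ ?_
    have h1 : Filter.Tendsto (fun ζ => (𝓕 ψ : SchwartzMap (Space d) ℂ) (ξ - ζ))
        (Filter.cocompact _) (nhds 0) := by
      have h2 : Filter.Tendsto (fun ζ : Space d => ξ - ζ) (Filter.cocompact _)
          (Filter.cocompact _) := (Homeomorph.subLeft ξ).isClosedEmbedding.tendsto_cocompact
      exact (zero_at_infty (𝓕 ψ : SchwartzMap (Space d) ℂ).toZeroAtInfty).comp h2
    have h3 : Filter.Tendsto (fun ζ => ‖G ζ‖) (Filter.cocompact _) (nhds 0) := by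
      refine squeeze_zero (fun _ => norm_nonneg _) (fun ζ => ?_)
        (by simpa using h1.norm.const_mul (∫ x, ‖f x‖))
      rw [hG, norm_mul]
      exact mul_le_mul_of_nonneg_right (norm_fourier_le ζ) (norm_nonneg _)
    exact (h3.eventually_lt_const (norm_pos_iff.2 hζ₀)).mono fun _ h => h.le
  have hpt : ∀ z ∈ Metric.ball x₀ ε, ∀ ω : Ω, z ∈ W ω → ‖𝓕 f ξ‖ * A ≤ ‖G ω‖ := by
    intro z hz ω hzω
    have hV := hW ω hzω
    have g1 : gauge (polarSet D) ((ω : Space d) - z) ≤ δ := by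
      have := ENNReal.toReal_mono hgt (gauge_sub_le_gap hV)
      rwa [ENNReal.toReal_ofReal (gauge_nonneg _)] at this
    have g2 : gauge (polarSet D) (z - x₀) ≤ κ := by
      refine (gauge_polarSet_le_mul_norm hR.le hRD _).trans ?_
      rw [mem_ball_iff_norm] at hz
      calc R * ‖z - x₀‖ ≤ R * ε := by gcongr
        _ = κ := by rw [hε]; field_simp
    have g3 : gauge (polarSet D) ((ω : Space d) - x₀) ≤ δ + κ := by
      have := gauge_add_le (convex_polarSet D)
        (absorbent_nhds_zero (𝕜 := ℝ) (polarSet_mem_nhds hD)) ((ω : Space d) - z) (z - x₀)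
      rw [sub_add_sub_cancel] at this
      linarith
    have g4 : r * ‖(ω : Space d) - x₀‖ ≤ (δ + 2 * κ) - (δ + κ) := by
      have := mul_norm_le_gauge_polarSet hD hr₀ hr₀D ((ω : Space d) - x₀)
      have h5 : r₀ * ‖(ω : Space d) - x₀‖ ≤ 1 / 4 := by
        refine this.trans (g3.trans ?_); rw [hκ]; linarith
      rw [hr]
      nlinarith
    have key := norm_fourier_mul_cos_le hD hf hfD hψi hψr (ρ := δ + 2 * κ) (by positivity)
      (by rw [hκ]; linarith) g3 g4 hx₀
    rw [add_sub_cancel] at key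
    refine le_trans ?_ key
    rw [hA, ← mul_assoc, ← norm_mul]
    have := hx₀ ξ
    simp only [hG, sub_self] at this
    exact mul_le_mul_of_nonneg_right this hc0.le
  have hG2 : ∀ ω : Ω, ‖G ω‖ₑ ^ 2 ≤
      ENNReal.ofReal (C₀ ^ 2) * (‖𝓕 f ω‖ₑ ^ 2 * decayKernel d (ξ - ω)) := by
    intro ω
    have hd1 : decayKernel d (ξ - ω) ≤ 1 := by
      rw [decayKernel, ENNReal.ofReal_le_one, Real.rpow_neg (by positivity)]
      exact inv_le_one_of_one_le₀ (Real.one_le_rpow (by linarith [norm_nonneg (ξ - (ω : Space d))])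
        (by positivity))
    rw [hG, enorm_mul, mul_pow, ENNReal.ofReal_pow hC₀.le, mul_left_comm]
    refine mul_le_mul_right ?_ _
    calc ‖𝓕 (ψ : Space d → ℂ) (ξ - ω)‖ₑ ^ 2
        ≤ (ENNReal.ofReal C₀ * decayKernel d (ξ - ω)) ^ 2 := by
          gcongr; exact hdec (ξ - ω)
      _ = ENNReal.ofReal C₀ ^ 2 * (decayKernel d (ξ - ω) * decayKernel d (ξ - ω)) := by ring
      _ ≤ ENNReal.ofReal C₀ ^ 2 * (1 * decayKernel d (ξ - ω)) := by gcongr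
      _ = _ := by rw [one_mul]
  -- The lower bound holds at every sample whose cell meets the ball around `x₀`. These cells cover
  -- the ball, so their volumes add up to at least the fixed number `m`. A single nearest sample
  -- would give no such control of its weight.
  have hsum : ENNReal.ofReal (A ^ 2 * m) * ‖𝓕 f ξ‖ₑ ^ 2 ≤ ENNReal.ofReal (C₀ ^ 2) *
      ∑' ω : Ω, volume (W ω) * ‖𝓕 f ω‖ₑ ^ 2 * decayKernel d (ξ - ω) := by
    have hmv : ENNReal.ofReal m = volume (Metric.ball x₀ ε) := by
      rw [hm, ENNReal.ofReal_toReal measure_ball_lt_top.ne]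
      exact (Measure.addHaar_ball_center volume x₀ ε).symm
    have hcov : volume (Metric.ball x₀ ε) ≤ ∑' ω : Ω, volume (W ω ∩ Metric.ball x₀ ε) := by
      refine le_trans (measure_mono ?_) (measure_iUnion_le _)
      rw [← Set.iUnion_inter, hWu, Set.univ_inter]
    calc ENNReal.ofReal (A ^ 2 * m) * ‖𝓕 f ξ‖ₑ ^ 2
        = ENNReal.ofReal (A ^ 2) * ‖𝓕 f ξ‖ₑ ^ 2 * volume (Metric.ball x₀ ε) := by
          rw [ENNReal.ofReal_mul (by positivity), hmv]; ring
      _ ≤ ENNReal.ofReal (A ^ 2) * ‖𝓕 f ξ‖ₑ ^ 2 * ∑' ω : Ω, volume (W ω ∩ Metric.ball x₀ ε) := by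
          gcongr
      _ = ∑' ω : Ω, ENNReal.ofReal (A ^ 2) * ‖𝓕 f ξ‖ₑ ^ 2 * volume (W ω ∩ Metric.ball x₀ ε) :=
          ENNReal.tsum_mul_left.symm
      _ ≤ ∑' ω : Ω, ENNReal.ofReal (C₀ ^ 2) *
            (volume (W ω) * ‖𝓕 f ω‖ₑ ^ 2 * decayKernel d (ξ - ω)) := by
          refine ENNReal.tsum_le_tsum fun ω => ?_
          rcases (W ω ∩ Metric.ball x₀ ε).eq_empty_or_nonempty with h | ⟨z, hz1, hz2⟩
          · rw [h, measure_empty, mul_zero]; exact zero_le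
          · have h1 : ENNReal.ofReal (A ^ 2) * ‖𝓕 f ξ‖ₑ ^ 2 ≤ ‖G ω‖ₑ ^ 2 := by
              rw [ENNReal.ofReal_pow hA0.le, ← mul_pow]
              gcongr
              rw [← ofReal_norm, ← ofReal_norm, ← ENNReal.ofReal_mul hA0.le, mul_comm]
              exact ENNReal.ofReal_le_ofReal (hpt z hz2 ω hz1)
            calc _ ≤ (ENNReal.ofReal (C₀ ^ 2) * (‖𝓕 f ω‖ₑ ^ 2 * decayKernel d (ξ - ω)))
                  * volume (W ω) := by
                  exact mul_le_mul' (h1.trans (hG2 ω)) (measure_mono Set.inter_subset_left)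
              _ = _ := by ring
      _ = _ := ENNReal.tsum_mul_left
  rw [div_eq_mul_inv, ENNReal.ofReal_mul (by positivity), ENNReal.ofReal_inv_of_pos (by positivity),
    mul_comm (ENNReal.ofReal (C₀ ^ 2)), mul_assoc]
  rw [← ENNReal.div_eq_inv_mul, ENNReal.le_div_iff_mul_le (Or.inl (by
    rw [Ne, ENNReal.ofReal_eq_zero, not_le]; positivity)) (Or.inl ENNReal.ofReal_ne_top), mul_comm]
  exact hsum

/-- Voronoi regions can be shrunk to a measurable partition. -/
theorem exists_partition_voronoiRegion (hD : IsCenteredSymmConvexBody D) {Ω : Set (Space d)}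
    (hΩ_closed : IsClosed Ω) (hΩ_countable : Ω.Countable) (hne : Ω.Nonempty) :
    ∃ W : Ω → Set (Space d), (∀ ω : Ω, W ω ⊆ voronoiRegion (polarSet D) Ω ω) ∧
      (∀ ω, MeasurableSet (W ω)) ∧ Pairwise (Function.onFun Disjoint W) ∧
      (⋃ ω, W ω) = Set.univ := by
  have hcount : Countable Ω := hΩ_countable.to_subtype
  -- Each region loses the regions that come earlier in an enumeration. Almost disjointness of the
  -- Voronoi regions is not assumed for this set, while the Bessel bound needs disjoint cells.
  obtain ⟨e, he⟩ := exists_injective_nat Ω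
  have hVm : ∀ ω : Ω, MeasurableSet (voronoiRegion (polarSet D) Ω ω) := fun ω =>
    (isClosed_voronoiRegion hD Ω ω).measurableSet
  refine ⟨fun ω => voronoiRegion (polarSet D) Ω ω \
    ⋃ ν : Ω, ⋃ _ : e ν < e ω, voronoiRegion (polarSet D) Ω ν, fun ω => Set.sdiff_subset,
    fun ω => (hVm ω).diff (MeasurableSet.iUnion fun ν => MeasurableSet.iUnion fun _ => hVm ν),
    ?_, ?_⟩
  · have key : ∀ ω ν : Ω, e ω < e ν → Disjoint
        (voronoiRegion (polarSet D) Ω ω \ ⋃ ν : Ω, ⋃ _ : e ν < e ω, voronoiRegion (polarSet D) Ω ν)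
        (voronoiRegion (polarSet D) Ω ν \
          ⋃ μ : Ω, ⋃ _ : e μ < e ν, voronoiRegion (polarSet D) Ω μ) := by
      intro ω ν h
      rw [Set.disjoint_left]
      rintro z ⟨h1, -⟩ ⟨-, h2⟩
      exact h2 (Set.mem_iUnion₂.2 ⟨ω, h, h1⟩)
    intro ω ν hne
    rcases lt_or_gt_of_ne (he.ne hne) with h | h
    · exact key ω ν h
    · exact (key ν ω h).symm
  · rw [Set.eq_univ_iff_forall]
    intro z
    obtain ⟨ω, hω, hz⟩ := exists_mem_voronoiRegion hD hΩ_closed hne z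
    have hex : ∃ n, ∃ ν : Ω, e ν = n ∧ z ∈ voronoiRegion (polarSet D) Ω ν := ⟨_, ⟨ω, hω⟩, rfl, hz⟩
    classical
    obtain ⟨ν, hν, hzν⟩ := Nat.find_spec hex
    refine Set.mem_iUnion.2 ⟨ν, hzν, fun h => ?_⟩
    obtain ⟨μ, hμ, hzμ⟩ := Set.mem_iUnion₂.1 h
    rw [hν] at hμ
    exact Nat.find_min hex hμ ⟨μ, rfl, hzμ⟩

theorem ae_lt_norm_imp_eq_zero {f : Space d → ℂ} {R : ℝ} (hRD : ∀ x ∈ D, ‖x‖ ≤ R)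
    (hf : ∀ᵐ x, x ∉ D → f x = 0) : ∀ᵐ x, R < ‖x‖ → f x = 0 := by
  filter_upwards [hf] with x hx hxR
  exact hx fun hxD => absurd (hRD x hxD) (not_le.2 hxR)

/-- For a set of gap less than `1/4`, the low-frequency energy is controlled by the samples. -/
theorem exists_lowFrequency_le_of_gap_lt (hD : IsCenteredSymmConvexBody D) {Ω : Set (Space d)}
    (hΩ_closed : IsClosed Ω) (hΩ_countable : Ω.Countable) (hgap : gap (polarSet D) Ω < 1 / 4) :
    ∃ C : ℝ, 0 < C ∧ ∀ η : ℝ, 0 < η → ∃ L : ℝ, 1 ≤ L ∧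
      ∀ (K : ℝ) (f : Lp ℂ 2 (volume : Measure (Space d))), 1 ≤ K →
      (∀ᵐ x : Space d, x ∉ D → f x = 0) → ‖f‖ = 1 →
        ∫⁻ ξ in Metric.closedBall 0 K, ‖𝓕 (fun x : Space d => f x) ξ‖ₑ ^ 2 ≤
        ENNReal.ofReal C * (∑' ω : {ω : Space d // ω ∈ Ω ∧ ‖ω‖ ≤ L * K},
          voronoiWeight (polarSet D) Ω ω * ‖𝓕 (fun x : Space d => f x) (ω : Space d)‖ₑ ^ 2)
        + ENNReal.ofReal η := by
  have hcount : Countable Ω := hΩ_countable.to_subtype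
  have hgt : gap (polarSet D) Ω < ⊤ := hgap.trans (by norm_num)
  obtain ⟨r₀, hr₀, hr₀D⟩ := hD.exists_closedBall_subset
  obtain ⟨R, hR, hRD⟩ := hD.exists_norm_le
  obtain ⟨W, hWV, hWm, hWd, hWu⟩ := exists_partition_voronoiRegion hD hΩ_closed hΩ_countable
    (nonempty_of_gap_lt_top hgt)
  obtain ⟨C, hC, hpt⟩ := exists_enorm_fourier_sq_le_tsum hD hΩ_countable hgap
  have hWr : ∀ ω : Ω, ∀ z ∈ W ω, ‖(ω : Space d) - z‖ ≤ (gap (polarSet D) Ω).toReal / r₀ := by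
    intro ω z hz
    rw [le_div_iff₀ hr₀, mul_comm]
    refine (mul_norm_le_gauge_polarSet hD hr₀ hr₀D _).trans ?_
    have := ENNReal.toReal_mono hgt.ne (gauge_sub_le_gap (hWV ω hz))
    rwa [ENNReal.toReal_ofReal (gauge_nonneg _)] at this
  obtain ⟨C', hC', hB⟩ := exists_tsum_cells_le_lintegral d R ((gap (polarSet D) Ω).toReal / r₀)
  set J := ∫⁻ y, decayKernel d y with hJ
  have hJt : J < ∞ := lintegral_decayKernel_lt_top d
  refine ⟨C * (J.toReal + 1), by positivity, fun η hη => ?_⟩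
  obtain ⟨M, hM, htail⟩ := exists_decayKernel_tail_le d (η := ENNReal.ofReal (η / (C * C')))
    (by rw [ENNReal.ofReal_pos]; positivity)
  -- For `K ≥ 1` a sample outside radius `(1 + M)K` is at distance more than `M` from the ball of
  -- radius `K`.
  refine ⟨1 + M, by linarith, fun K f hK hf hf1 => ?_⟩
  have hfR := ae_lt_norm_imp_eq_zero hRD hf
  have hi := Lp.integrable_of_ae_support hfR
  set F : Space d → ℂ := 𝓕 (fun x : Space d => f x) with hF
  have hbessel := hB (fun x => f x) hi hfR Ω (fun ω => ω) W hWm (fun ω ν h => (hWd h).aedisjoint) hWr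
  rw [Lp.lintegral_fourier_sq_eq_one hi hf1, mul_one, ← hF] at hbessel
  have hin : ∀ ω : Space d, ∫⁻ ξ in Metric.closedBall 0 K, decayKernel d (ξ - ω) ≤
      ENNReal.ofReal (J.toReal + 1) := fun ω => by
    refine ((setLIntegral_le_lintegral _ _).trans (lintegral_sub_right_eq_self _ _).le).trans ?_
    rw [ENNReal.ofReal_add (by positivity) (by positivity), ENNReal.ofReal_toReal hJt.ne]
    exact le_self_add
  have hout : ∀ ω : Space d, ¬ ‖ω‖ ≤ (1 + M) * K →
      ∫⁻ ξ in Metric.closedBall 0 K, decayKernel d (ξ - ω) ≤ ENNReal.ofReal (η / (C * C')) := by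
    intro ω hω
    refine le_trans ?_ htail
    have hms : MeasurableSet {y : Space d | M < ‖y‖} :=
      measurableSet_lt measurable_const measurable_norm
    rw [← lintegral_indicator hms,
      ← lintegral_sub_right_eq_self (μ := (volume : Measure (Space d)))
        ({y : Space d | M < ‖y‖}.indicator (decayKernel d)) ω,
      ← lintegral_indicator Metric.isClosed_closedBall.measurableSet]
    refine lintegral_mono fun z => ?_
    by_cases hz : z ∈ Metric.closedBall (0 : Space d) K
    · rw [Set.indicator_of_mem hz, Set.indicator_of_mem]
      rw [mem_closedBall_zero_iff] at hz
      have h3 : ‖ω‖ ≤ ‖z‖ + ‖z - ω‖ := by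
        simpa using norm_sub_le z (z - ω)
      change M < ‖z - ω‖
      nlinarith
    · rw [Set.indicator_of_notMem hz]; exact zero_le
  set B : Set (Space d) := {ω | ‖ω‖ ≤ (1 + M) * K} with hBdef
  calc ∫⁻ ξ in Metric.closedBall 0 K, ‖F ξ‖ₑ ^ 2
      ≤ ∫⁻ ξ in Metric.closedBall 0 K, ENNReal.ofReal C *
          ∑' ω : Ω, volume (W ω) * ‖F ω‖ₑ ^ 2 * decayKernel d (ξ - ω) :=
        lintegral_mono fun ξ => hpt _ hi hf W hWV hWu ξ
    _ = ENNReal.ofReal C * ∑' ω : Ω, volume (W ω) * ‖F ω‖ₑ ^ 2 *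
          ∫⁻ ξ in Metric.closedBall 0 K, decayKernel d (ξ - ω) := by
        have hmk : ∀ ω : Ω, Measurable fun ξ : Space d => decayKernel d (ξ - ω) := fun ω =>
          (measurable_decayKernel d).comp (measurable_id.sub measurable_const)
        rw [lintegral_const_mul' _ _ ENNReal.ofReal_ne_top,
          lintegral_tsum fun ω => ((hmk ω).const_mul _).aemeasurable]
        congr 2 with ω
        rw [lintegral_const_mul _ (hmk ω)]
    -- Near samples take the full mass of the kernel and the Voronoi weight. Far samples take only
    -- the tail and keep the volume of the disjoint cell, so that Bessel's inequality with constant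
    -- `C'` sums them to at most `η` after multiplication by `C`.
    _ ≤ ENNReal.ofReal C * ∑' ω : Ω, (ENNReal.ofReal (J.toReal + 1) *
          B.indicator (fun ω => voronoiWeight (polarSet D) Ω ω * ‖F ω‖ₑ ^ 2) ω +
          ENNReal.ofReal (η / (C * C')) * (volume (W ω) * ‖F ω‖ₑ ^ 2)) := by
        refine mul_le_mul_right (ENNReal.tsum_le_tsum fun ω => ?_) _
        by_cases hω : (ω : Space d) ∈ B
        · rw [Set.indicator_of_mem hω]
          refine le_add_right ?_
          rw [mul_comm]
          refine mul_le_mul' (hin _) (mul_le_mul_left (measure_mono (hWV ω)) _)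
        · refine le_add_left ?_
          rw [mul_comm]
          exact mul_le_mul_left (hout _ hω) _
    _ = ENNReal.ofReal C * (ENNReal.ofReal (J.toReal + 1) *
          (∑' ω : {ω : Space d // ω ∈ Ω ∧ ‖ω‖ ≤ (1 + M) * K},
          voronoiWeight (polarSet D) Ω ω * ‖F (ω : Space d)‖ₑ ^ 2) +
          ENNReal.ofReal (η / (C * C')) * ∑' ω : Ω, (volume (W ω) * ‖F ω‖ₑ ^ 2)) := by
        rw [ENNReal.tsum_add, ENNReal.tsum_mul_left, ENNReal.tsum_mul_left]
        congr 3
        rw [tsum_subtype Ω (B.indicator fun ω => voronoiWeight (polarSet D) Ω ω * ‖F ω‖ₑ ^ 2),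
          Set.indicator_indicator]
        exact (tsum_subtype (Ω ∩ B) fun ω => voronoiWeight (polarSet D) Ω ω * ‖F ω‖ₑ ^ 2).symm
    _ ≤ _ := by
        rw [mul_add, ← mul_assoc, ← ENNReal.ofReal_mul hC.le]
        refine add_le_add le_rfl ?_
        calc _ ≤ ENNReal.ofReal C * (ENNReal.ofReal (η / (C * C')) * ENNReal.ofReal C') := by
              gcongr
          _ = ENNReal.ofReal η := by
              rw [← ENNReal.ofReal_mul (by positivity), ← ENNReal.ofReal_mul (by positivity)]
              congr 1
              field_simp

end DenseSampling

end FourierSampling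

/-! ### Cardinal series in one variable. -/

namespace FourierSampling

theorem integral_cexp_two_pi_mul (c : ℝ) :
    ∫ x in (-(1 / 2) : ℝ)..(1 / 2), Complex.exp (2 * Real.pi * Complex.I * c * x)
      = Real.sinc (Real.pi * c) := by
  by_cases hc : c = 0
  · subst hc
    simp
    norm_num
  have hc0 : (c : ℂ) ≠ 0 := by exact_mod_cast hc
  have hπ : (Real.pi : ℂ) ≠ 0 := by exact_mod_cast Real.pi_ne_zero
  have hI := Complex.I_ne_zero
  have hc' : (2 * Real.pi * Complex.I * c : ℂ) ≠ 0 := by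
    simp [hc0, hπ, hI]
  rw [integral_exp_mul_complex hc', Real.sinc_of_ne_zero (by positivity),
    Complex.ofReal_div (Real.sin _), Complex.ofReal_sin, Complex.sin]
  have e1 : Complex.exp (2 * Real.pi * Complex.I * c * ((1 / 2 : ℝ) : ℂ))
      = Complex.exp (((Real.pi * c : ℝ) : ℂ) * Complex.I) := by
    congr 1; push_cast; ring
  have e2 : Complex.exp (2 * Real.pi * Complex.I * c * ((-(1 / 2) : ℝ) : ℂ))
      = Complex.exp (-((Real.pi * c : ℝ) : ℂ) * Complex.I) := by
    congr 1; push_cast; ring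
  rw [e1, e2, div_eq_div_iff hc' (by push_cast; simp [hc0, hπ])]
  push_cast
  linear_combination (Real.pi * c * (Complex.exp (Real.pi * c * Complex.I)
    - Complex.exp (-(Real.pi * c) * Complex.I))) * Complex.I_sq

theorem sinc_pi_mul_int (m n : ℤ) :
    Real.sinc (Real.pi * ((m : ℝ) - n)) = if m = n then 1 else 0 := by
  split_ifs with h
  · simp [h]
  · have : (m : ℝ) - n ≠ 0 := sub_ne_zero.2 (by exact_mod_cast h)
    rw [Real.sinc_of_ne_zero (mul_ne_zero Real.pi_ne_zero this), mul_comm,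
      ← Int.cast_sub, Real.sin_int_mul_pi, zero_div]

/-- The `L²(-1/2, 1/2)` norm of an exponential sum. -/
theorem integral_norm_sq_exp_sum {ι : Type*} (S : Finset ι) (c : ι → ℂ) (t : ι → ℝ) :
    ((∫ x in (-(1 / 2) : ℝ)..(1 / 2),
      ‖∑ j ∈ S, c j * Complex.exp (2 * Real.pi * Complex.I * t j * x)‖ ^ 2 : ℝ) : ℂ)
      = ∑ j ∈ S, ∑ k ∈ S, c j * (starRingEnd ℂ) (c k) * Real.sinc (Real.pi * (t j - t k)) := by
  rw [← intervalIntegral.integral_ofReal]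
  have e : ∀ x : ℝ, ((‖∑ j ∈ S, c j * Complex.exp (2 * Real.pi * Complex.I * t j * x)‖ ^ 2 : ℝ) : ℂ)
      = ∑ j ∈ S, ∑ k ∈ S, c j * (starRingEnd ℂ) (c k) *
        Complex.exp (2 * Real.pi * Complex.I * ((t j - t k : ℝ) : ℂ) * x) := by
    intro x
    rw [← Complex.normSq_eq_norm_sq, ← Complex.mul_conj, map_sum, Finset.sum_mul_sum]
    refine Finset.sum_congr rfl fun j _ => Finset.sum_congr rfl fun k _ => ?_
    rw [map_mul, ← Complex.exp_conj, mul_mul_mul_comm, ← Complex.exp_add]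
    congr 2
    simp only [map_mul, Complex.conj_ofReal, Complex.conj_I, map_ofNat]
    push_cast
    ring
  simp only [e]
  rw [intervalIntegral.integral_finsetSum fun j _ => by
    apply Continuous.intervalIntegrable; fun_prop]
  refine Finset.sum_congr rfl fun j _ => ?_
  rw [intervalIntegral.integral_finsetSum fun k _ => by
    apply Continuous.intervalIntegrable; fun_prop]
  refine Finset.sum_congr rfl fun k _ => ?_
  rw [intervalIntegral.integral_const_mul, integral_cexp_two_pi_mul]

/-- Parseval's identity for the exponential of frequency `t` on `(-1/2, 1/2)`, whose Fourier
coefficients are these sinc values. -/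
theorem hasSum_sinc_sq (t : ℝ) :
    HasSum (fun m : ℤ => Real.sinc (Real.pi * (t - m)) ^ 2) 1 := by
  have hab : (-(1 / 2) : ℝ) < 1 / 2 := by norm_num
  have hL2 : MemLp (fun x : ℝ => Complex.exp (2 * Real.pi * Complex.I * t * x)) 2
      (volume.restrict (Set.Ioc (-(1 / 2)) (1 / 2))) := by
    refine MemLp.of_bound (by apply Continuous.aestronglyMeasurable; fun_prop) 1 ?_
    refine Filter.Eventually.of_forall fun x => ?_
    rw [show 2 * Real.pi * Complex.I * t * x = ((2 * Real.pi * t * x : ℝ) : ℂ) * Complex.I by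
      push_cast; ring, Complex.norm_exp_ofReal_mul_I]
  have h := hasSum_sq_fourierCoeffOn hab hL2
  have hn : ∀ x : ℝ, ‖Complex.exp (2 * Real.pi * Complex.I * t * x)‖ = 1 := fun x => by
    rw [show 2 * Real.pi * Complex.I * t * x = ((2 * Real.pi * t * x : ℝ) : ℂ) * Complex.I by
      push_cast; ring, Complex.norm_exp_ofReal_mul_I]
  convert h using 1
  · ext m
    rw [fourierCoeffOn_eq_integral]
    have e : ∀ x : ℝ, fourier (-m) (x : AddCircle ((1 / 2 : ℝ) - (-(1 / 2)))) •
        Complex.exp (2 * Real.pi * Complex.I * t * x)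
        = Complex.exp (2 * Real.pi * Complex.I * ((t - m : ℝ) : ℂ) * x) := by
      intro x
      rw [fourier_coe_apply, smul_eq_mul, ← Complex.exp_add]
      congr 1
      push_cast
      ring
    simp only [e]
    rw [integral_cexp_two_pi_mul, norm_smul, Complex.norm_real, mul_pow]
    simp only [Real.norm_eq_abs, sq_abs]
    norm_num
  · simp only [hn]
    norm_num

/-- The `L²(-1/2, 1/2)` distance of an exponential to a trigonometric polynomial. -/
theorem lintegral_exp_sub_sum_sq (t : ℝ) (S : Finset ℤ) :
    ∫⁻ x in Set.Icc (-(1 / 2) : ℝ) (1 / 2), ‖Complex.exp (-(2 * Real.pi * Complex.I * t * x)) -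
        ∑ m ∈ S, (Real.sinc (Real.pi * (t - m)) : ℂ) *
          Complex.exp (-(2 * Real.pi * Complex.I * m * x))‖ₑ ^ 2
      = ENNReal.ofReal (1 - ∑ m ∈ S, Real.sinc (Real.pi * (t - m)) ^ 2) := by
  set E : ℝ → ℂ := fun x => Complex.exp (-(2 * Real.pi * Complex.I * t * x)) -
        ∑ m ∈ S, (Real.sinc (Real.pi * (t - m)) : ℂ) *
          Complex.exp (-(2 * Real.pi * Complex.I * m * x)) with hE
  have hc : Continuous E := by rw [hE]; fun_prop
  -- The index `none` carries the exponential of frequency `-t` with coefficient one, the integers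
  -- the approximating polynomial. In the Gram expansion each integer row cancels, leaving the row
  -- of `none`.
  have key := integral_norm_sq_exp_sum (Finset.insertNone S)
    (fun j => j.elim (1 : ℂ) fun m => -(Real.sinc (Real.pi * (t - m)) : ℂ))
    (fun j => j.elim (-t) fun m => -(m : ℝ))
  have e : ∀ x : ℝ, ∑ j ∈ Finset.insertNone S,
      (j.elim (1 : ℂ) fun m => -(Real.sinc (Real.pi * (t - m)) : ℂ)) *
        Complex.exp (2 * Real.pi * Complex.I * ((j.elim (-t) fun m => -(m : ℝ) : ℝ) : ℂ) * x)
      = E x := by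
    intro x
    rw [Finset.sum_insertNone]
    simp only [hE, Option.elim]
    rw [sub_eq_add_neg, ← Finset.sum_neg_distrib]
    congr 1
    · rw [one_mul]; congr 1; push_cast; ring
    · refine Finset.sum_congr rfl fun m _ => ?_
      rw [neg_mul]; congr 3; push_cast; ring
  simp only [e] at key
  have hval : (∫ x in (-(1 / 2) : ℝ)..(1 / 2), ‖E x‖ ^ 2 : ℝ)
      = 1 - ∑ m ∈ S, Real.sinc (Real.pi * (t - m)) ^ 2 := by
    have hneg : ∀ a b : ℝ, Real.sinc (Real.pi * (-a - -b)) = Real.sinc (Real.pi * (a - b)) := by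
      intro a b
      rw [← Real.sinc_neg]; congr 1; ring
    have hneg' : ∀ m : ℤ, Real.sinc (Real.pi * ((m : ℝ) - t)) = Real.sinc (Real.pi * (t - m)) := by
      intro m
      rw [← Real.sinc_neg]; congr 1; ring
    have : (((∫ x in (-(1 / 2) : ℝ)..(1 / 2), ‖E x‖ ^ 2 : ℝ)) : ℂ)
        = ((1 - ∑ m ∈ S, Real.sinc (Real.pi * (t - m)) ^ 2 : ℝ) : ℂ) := by
      rw [key, Finset.sum_insertNone]
      simp only [Finset.sum_insertNone, Option.elim, hneg, hneg', sinc_pi_mul_int, sub_self,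
        mul_zero, Real.sinc_zero, map_one, map_neg, Complex.conj_ofReal, one_mul]
      have h3 : ∀ m ∈ S, (-(Real.sinc (Real.pi * (t - m)) : ℂ) * 1 *
          (Real.sinc (Real.pi * (t - m)) : ℂ) + ∑ n ∈ S, -(Real.sinc (Real.pi * (t - m)) : ℂ) *
            -(Real.sinc (Real.pi * (t - n)) : ℂ) * ((if m = n then (1 : ℝ) else 0 : ℝ) : ℂ)) = 0 := by
        intro m hm
        rw [Finset.sum_eq_single m (fun n _ hn => by simp [hn.symm]) (fun h => absurd hm h)]
        simp
      rw [Finset.sum_congr rfl h3]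
      push_cast
      simp only [Finset.sum_const_zero, add_zero, neg_mul, Finset.sum_neg_distrib, sq]
      ring
    exact_mod_cast this
  rw [← hval, intervalIntegral.integral_of_le (by norm_num), ← integral_Icc_eq_integral_Ioc,
    ofReal_integral_eq_lintegral_ofReal]
  · refine lintegral_congr fun x => ?_
    rw [← ofReal_norm, ENNReal.ofReal_pow (norm_nonneg _)]
  · exact (hc.norm.pow 2).continuousOn.integrableOn_compact isCompact_Icc
  · exact Filter.Eventually.of_forall fun x => by positivity

/-- Integer translates of the cardinal sine are orthonormal in `L²(ℝ)`. -/
theorem lintegral_sinc_sum_sq (S : Finset ℤ) (c : ℤ → ℂ) :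
    ∫⁻ t : ℝ, ‖∑ m ∈ S, (Real.sinc (Real.pi * (t - m)) : ℂ) * c m‖ₑ ^ 2 = ∑ m ∈ S, ‖c m‖ₑ ^ 2 := by
  -- The sinc sum is the Fourier transform of this truncated trigonometric polynomial, so Plancherel
  -- reduces the claim to orthonormality of the exponentials.
  set g : ℝ → ℂ := (Set.Icc (-(1 / 2) : ℝ) (1 / 2)).indicator
    fun x => ∑ m ∈ S, c m * Complex.exp (2 * Real.pi * Complex.I * (m : ℝ) * x) with hg
  have hc : Continuous fun x : ℝ => ∑ m ∈ S, c m *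
      Complex.exp (2 * Real.pi * Complex.I * (m : ℝ) * x) := by fun_prop
  have hmI : MeasurableSet (Set.Icc (-(1 / 2) : ℝ) (1 / 2)) := measurableSet_Icc
  have hgi : Integrable g := (integrable_indicator_iff hmI).2
    (hc.continuousOn.integrableOn_compact isCompact_Icc)
  obtain ⟨B, hB⟩ := (isCompact_Icc (a := (-(1 / 2) : ℝ)) (b := 1 / 2)).exists_bound_of_continuousOn
    hc.continuousOn
  have hg2 : MemLp g 2 := by
    rw [hg, memLp_indicator_iff_restrict hmI]
    refine MemLp.of_bound hc.aestronglyMeasurable B ?_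
    filter_upwards [ae_restrict_mem hmI] with x hx using hB x hx
  have hF : ∀ t : ℝ, 𝓕 g t = ∑ m ∈ S, (Real.sinc (Real.pi * (t - m)) : ℂ) * c m := by
    intro t
    rw [Real.fourier_real_eq_integral_exp_smul]
    have e : ∀ x : ℝ, Complex.exp (((-2 * Real.pi * x * t : ℝ) : ℂ) * Complex.I) • g x
        = (Set.Icc (-(1 / 2) : ℝ) (1 / 2)).indicator (fun x : ℝ => ∑ m ∈ S,
          c m * Complex.exp (2 * Real.pi * Complex.I * ((m - t : ℝ) : ℂ) * x)) x := by
      intro x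
      by_cases hx : x ∈ Set.Icc (-(1 / 2) : ℝ) (1 / 2)
      · rw [hg, Set.indicator_of_mem hx, Set.indicator_of_mem hx, smul_eq_mul, Finset.mul_sum]
        refine Finset.sum_congr rfl fun m _ => ?_
        rw [mul_left_comm, ← Complex.exp_add]
        congr 2
        push_cast
        ring
      · rw [hg, Set.indicator_of_notMem hx, Set.indicator_of_notMem hx, smul_zero]
    simp only [e]
    rw [integral_indicator hmI, integral_Icc_eq_integral_Ioc,
      ← intervalIntegral.integral_of_le (by norm_num), intervalIntegral.integral_finsetSum fun j _ => by
        apply Continuous.intervalIntegrable; fun_prop]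
    refine Finset.sum_congr rfl fun m _ => ?_
    rw [intervalIntegral.integral_const_mul, integral_cexp_two_pi_mul, mul_comm]
    congr 2
    rw [← Real.sinc_neg]; congr 1; ring
  have hP := lintegral_fourier_sq hgi hg2
  simp only [hF] at hP
  rw [hP]
  have key := integral_norm_sq_exp_sum S c (fun m => (m : ℝ))
  have hval : (∫ x in (-(1 / 2) : ℝ)..(1 / 2),
      ‖∑ m ∈ S, c m * Complex.exp (2 * Real.pi * Complex.I * (m : ℝ) * x)‖ ^ 2 : ℝ)
      = ∑ m ∈ S, ‖c m‖ ^ 2 := by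
    have : (((∫ x in (-(1 / 2) : ℝ)..(1 / 2),
      ‖∑ m ∈ S, c m * Complex.exp (2 * Real.pi * Complex.I * (m : ℝ) * x)‖ ^ 2 : ℝ)) : ℂ)
        = ((∑ m ∈ S, ‖c m‖ ^ 2 : ℝ) : ℂ) := by
      rw [key]
      simp only [sinc_pi_mul_int]
      push_cast
      refine Finset.sum_congr rfl fun m hm => ?_
      rw [Finset.sum_eq_single m (fun n _ hn => by simp [hn.symm]) (fun h => absurd hm h)]
      simp [Complex.mul_conj, Complex.normSq_eq_norm_sq]
    exact_mod_cast this
  have hpt : ∀ x, ‖g x‖ₑ ^ 2 = (Set.Icc (-(1 / 2) : ℝ) (1 / 2)).indicator (fun x => ENNReal.ofReal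
      (‖∑ m ∈ S, c m * Complex.exp (2 * Real.pi * Complex.I * (m : ℝ) * x)‖ ^ 2)) x := by
    intro x
    by_cases hx : x ∈ Set.Icc (-(1 / 2) : ℝ) (1 / 2)
    · rw [hg, Set.indicator_of_mem hx, Set.indicator_of_mem hx, ← ofReal_norm,
        ENNReal.ofReal_pow (norm_nonneg _)]
    · rw [hg, Set.indicator_of_notMem hx, Set.indicator_of_notMem hx]; simp
  simp only [hpt]
  have hci : IntegrableOn (fun x : ℝ => ‖∑ m ∈ S, c m *
      Complex.exp (2 * Real.pi * Complex.I * (m : ℝ) * x)‖ ^ 2) (Set.Icc (-(1 / 2)) (1 / 2)) :=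
    (hc.norm.pow 2).continuousOn.integrableOn_compact isCompact_Icc
  rw [lintegral_indicator hmI, ← ofReal_integral_eq_lintegral_ofReal hci
    (Filter.Eventually.of_forall fun x => by positivity), integral_Icc_eq_integral_Ioc,
    ← intervalIntegral.integral_of_le (by norm_num), hval,
    ENNReal.ofReal_sum_of_nonneg fun _ _ => by positivity]
  refine Finset.sum_congr rfl fun m _ => ?_
  rw [← ofReal_norm, ENNReal.ofReal_pow (norm_nonneg _)]

theorem sum_int_inv_sq_le {x : ℝ} (hx : 0 < x) (T : Finset ℤ) (hT : ∀ m ∈ T, x < |(m : ℝ)|) :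
    ∑ m ∈ T, ((m : ℝ) ^ 2)⁻¹ ≤ 4 / x := by
  classical
  set k := ⌊x⌋₊
  set N := T.sup Int.natAbs + 1
  have hsub : T ⊆ (Finset.Ioo k N).image (fun n : ℕ => (n : ℤ)) ∪
      (Finset.Ioo k N).image (fun n : ℕ => -(n : ℤ)) := by
    intro m hm
    have h1 : m.natAbs ∈ Finset.Ioo k N := by
      rw [Finset.mem_Ioo]
      constructor
      · rw [Nat.floor_lt hx.le, Nat.cast_natAbs, Int.cast_abs]
        exact hT m hm
      · exact Nat.lt_succ_of_le (Finset.le_sup (f := Int.natAbs) hm)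
    rw [Finset.mem_union, Finset.mem_image, Finset.mem_image]
    rcases Int.natAbs_eq m with h | h
    · exact Or.inl ⟨_, h1, h.symm⟩
    · exact Or.inr ⟨_, h1, h.symm⟩
  have hhalf : ∑ i ∈ Finset.Ioo k N, ((i : ℝ) ^ 2)⁻¹ ≤ 2 / x := by
    refine (sum_Ioo_inv_sq_le (α := ℝ) k N).trans ?_
    gcongr
    exact (Nat.lt_floor_add_one x).le
  calc ∑ m ∈ T, ((m : ℝ) ^ 2)⁻¹
      ≤ ∑ m ∈ (Finset.Ioo k N).image (fun n : ℕ => (n : ℤ)) ∪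
          (Finset.Ioo k N).image (fun n : ℕ => -(n : ℤ)), ((m : ℝ) ^ 2)⁻¹ :=
        Finset.sum_le_sum_of_subset_of_nonneg hsub fun _ _ _ => by positivity
    _ ≤ ∑ m ∈ (Finset.Ioo k N).image (fun n : ℕ => (n : ℤ)), ((m : ℝ) ^ 2)⁻¹ +
          ∑ m ∈ (Finset.Ioo k N).image (fun n : ℕ => -(n : ℤ)), ((m : ℝ) ^ 2)⁻¹ := by
        rw [← Finset.sum_union_inter]
        exact le_add_of_nonneg_right (Finset.sum_nonneg fun _ _ => by positivity)
    _ = ∑ i ∈ Finset.Ioo k N, ((i : ℝ) ^ 2)⁻¹ + ∑ i ∈ Finset.Ioo k N, ((i : ℝ) ^ 2)⁻¹ := by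
        rw [Finset.sum_image fun a _ b _ h => by simpa using h,
          Finset.sum_image fun a _ b _ h => by simpa using h]
        simp
    _ ≤ 2 / x + 2 / x := add_le_add hhalf hhalf
    _ = 4 / x := by ring

/-- Here `|t - m| ≥ |m| / 2`, and `π ≥ 2` absorbs the factor `1/2`. -/
theorem sinc_sq_le {t : ℝ} {m : ℤ} (h : 2 * |t| ≤ |(m : ℝ)|) (hm : m ≠ 0) :
    Real.sinc (Real.pi * (t - m)) ^ 2 ≤ ((m : ℝ) ^ 2)⁻¹ := by
  have hm0 : 0 < |(m : ℝ)| := abs_pos.2 (by exact_mod_cast hm)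
  have h1 : |(m : ℝ)| / 2 ≤ |t - m| := by
    have := abs_sub_abs_le_abs_sub (m : ℝ) t
    rw [abs_sub_comm] at this
    linarith
  have h0 : 0 < |t - m| := by linarith
  have hne : Real.pi * (t - m) ≠ 0 := mul_ne_zero Real.pi_ne_zero (abs_pos.1 h0)
  rw [Real.sinc_of_ne_zero hne, div_pow, ← one_div, ← sq_abs (m : ℝ)]
  have h2 : |(m : ℝ)| ≤ |Real.pi * (t - m)| := by
    rw [abs_mul, abs_of_pos Real.pi_pos]
    nlinarith [Real.two_le_pi]
  have h3 : |(m : ℝ)| ^ 2 ≤ (Real.pi * (t - m)) ^ 2 := by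
    rw [← sq_abs (Real.pi * (t - m))]
    gcongr
  have h4 : Real.sin (Real.pi * (t - m)) ^ 2 ≤ 1 := Real.sin_sq_le_one _
  gcongr

/-- The energy of a cardinal series is at most the energy of its samples. -/
theorem lintegral_cardinal_sq_le {G : ℝ → ℂ}
    (h : ∀ t : ℝ, HasSum (fun m : ℤ => (Real.sinc (Real.pi * (t - m)) : ℂ) * G m) (G t)) :
    ∫⁻ t, ‖G t‖ₑ ^ 2 ≤ ∑' m : ℤ, ‖G m‖ₑ ^ 2 := by
  set S : ℕ → Finset ℤ := fun N => Finset.Icc (-(N : ℤ)) N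
  have hS : Filter.Tendsto S Filter.atTop Filter.atTop := by
    refine Filter.tendsto_atTop_finset_of_monotone (fun a b hab => ?_) fun m => ⟨m.natAbs, ?_⟩
    · refine Finset.Icc_subset_Icc ?_ ?_ <;> omega
    · rw [Finset.mem_Icc]; omega
  set P : ℕ → ℝ → ℂ := fun N t => ∑ m ∈ S N, (Real.sinc (Real.pi * (t - m)) : ℂ) * G m
  have hlim : ∀ t, Filter.Tendsto (fun N => ‖P N t‖ₑ ^ 2) Filter.atTop (nhds (‖G t‖ₑ ^ 2)) :=
    fun t => ENNReal.Tendsto.pow (((h t).comp hS).enorm)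
  have hPc : ∀ N, Continuous (P N) := fun N => by
    refine continuous_finsetSum _ fun m _ => Continuous.mul ?_ continuous_const
    exact Complex.continuous_ofReal.comp (Real.continuous_sinc.comp (by fun_prop))
  -- Fatou's lemma for the symmetric partial sums, whose energies are known exactly.
  calc ∫⁻ t, ‖G t‖ₑ ^ 2 = ∫⁻ t, Filter.liminf (fun N => ‖P N t‖ₑ ^ 2) Filter.atTop :=
        lintegral_congr fun t => (hlim t).liminf_eq.symm
    _ ≤ Filter.liminf (fun N => ∫⁻ t, ‖P N t‖ₑ ^ 2) Filter.atTop :=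
        lintegral_liminf_le fun N => ((hPc N).measurable.enorm).pow_const 2
    _ ≤ Filter.liminf (fun _ : ℕ => ∑' m : ℤ, ‖G m‖ₑ ^ 2) Filter.atTop := by
        refine Filter.liminf_le_liminf (Filter.Eventually.of_forall fun N => ?_)
        simp only [P]
        rw [lintegral_sinc_sum_sq]
        exact ENNReal.sum_le_tsum _
    _ = _ := Filter.liminf_const _

theorem enorm_sum_mul_sq_le (T : Finset ℤ) (a : ℤ → ℝ) (c : ℤ → ℂ) :
    ‖∑ m ∈ T, (a m : ℂ) * c m‖ₑ ^ 2 ≤ ENNReal.ofReal (∑ m ∈ T, a m ^ 2) * ∑' m, ‖c m‖ₑ ^ 2 := by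
  have h1 : ‖∑ m ∈ T, (a m : ℂ) * c m‖ ≤ ∑ m ∈ T, |a m| * ‖c m‖ := by
    refine (norm_sum_le _ _).trans (le_of_eq (Finset.sum_congr rfl fun m _ => ?_))
    rw [norm_mul, Complex.norm_real, Real.norm_eq_abs]
  have h2 : ‖∑ m ∈ T, (a m : ℂ) * c m‖ ^ 2 ≤ (∑ m ∈ T, a m ^ 2) * ∑ m ∈ T, ‖c m‖ ^ 2 := by
    refine (pow_le_pow_left₀ (norm_nonneg _) h1 2).trans ?_
    refine (Finset.sum_mul_sq_le_sq_mul_sq _ _ _).trans (le_of_eq ?_)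
    simp only [sq_abs]
  rw [← ofReal_norm, ← ENNReal.ofReal_pow (norm_nonneg _)]
  refine (ENNReal.ofReal_le_ofReal h2).trans ?_
  rw [ENNReal.ofReal_mul (Finset.sum_nonneg fun _ _ => sq_nonneg _)]
  refine mul_le_mul_right ?_ _
  rw [ENNReal.ofReal_sum_of_nonneg fun _ _ => by positivity]
  refine le_trans (le_of_eq ?_) (ENNReal.sum_le_tsum T)
  refine Finset.sum_congr rfl fun m _ => ?_
  rw [← ofReal_norm, ENNReal.ofReal_pow (norm_nonneg _)]

/-- The low-frequency energy of a cardinal series is controlled by the samples in a larger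
window. -/
theorem setLIntegral_cardinal_sq_le {G : ℝ → ℂ}
    (h : ∀ t : ℝ, HasSum (fun m : ℤ => (Real.sinc (Real.pi * (t - m)) : ℂ) * G m) (G t))
    {K L : ℝ} (hK : 0 < K) (hL : 2 ≤ L) (S : Finset ℤ) (hS : ∀ m : ℤ, |(m : ℝ)| ≤ L * K → m ∈ S) :
    ∫⁻ t in Set.Icc (-K) K, ‖G t‖ₑ ^ 2 ≤
      2 * ∑ m ∈ S, ‖G m‖ₑ ^ 2 + ENNReal.ofReal (16 / L) * ∑' m : ℤ, ‖G m‖ₑ ^ 2 := by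
  classical
  have hLK : 0 < L * K := by positivity
  set P : ℝ → ℂ := fun t => ∑ m ∈ S, (Real.sinc (Real.pi * (t - m)) : ℂ) * G m with hP
  set Z := ∑' m : ℤ, ‖G m‖ₑ ^ 2 with hZ
  -- By Cauchy–Schwarz the terms outside the window cost `4 / (L * K)` pointwise. Integration over
  -- an interval of length `2K`, with the factor 2 from squaring a sum, gives `16 / L`, independent
  -- of `K`.
  have htail : ∀ t ∈ Set.Icc (-K) K, ‖G t - P t‖ₑ ^ 2 ≤ ENNReal.ofReal (4 / (L * K)) * Z := by
    intro t ht
    have habs : |t| ≤ K := abs_le.2 ht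
    have hlim : Filter.Tendsto (fun T : Finset ℤ => ‖(∑ m ∈ T, (Real.sinc (Real.pi * (t - m)) : ℂ) *
        G m) - P t‖ₑ ^ 2) Filter.atTop (nhds (‖G t - P t‖ₑ ^ 2)) :=
      ENNReal.Tendsto.pow (Filter.Tendsto.enorm ((h t).sub_const (P t)))
    refine le_of_tendsto hlim ?_
    filter_upwards [Filter.eventually_ge_atTop S] with T hT
    have e : (∑ m ∈ T, (Real.sinc (Real.pi * (t - m)) : ℂ) * G m) - P t
        = ∑ m ∈ T \ S, (Real.sinc (Real.pi * (t - m)) : ℂ) * G m := by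
      rw [hP, ← Finset.sum_sdiff hT]; simp
    rw [e]
    refine (enorm_sum_mul_sq_le (T \ S) (fun m => Real.sinc (Real.pi * (t - m)))
      (fun m => G m)).trans ?_
    refine mul_le_mul_left (ENNReal.ofReal_le_ofReal ?_) _
    have hbig : ∀ m ∈ T \ S, L * K < |(m : ℝ)| := fun m hm => by
      by_contra hcon
      exact (Finset.mem_sdiff.1 hm).2 (hS m (not_lt.1 hcon))
    refine le_trans (Finset.sum_le_sum fun m hm => ?_) (sum_int_inv_sq_le hLK _ hbig)
    have := hbig m hm
    refine sinc_sq_le (by nlinarith) ?_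
    rintro rfl
    simp at this
    linarith
  have hpt : ∀ t ∈ Set.Icc (-K) K, ‖G t‖ₑ ^ 2 ≤
      2 * ‖P t‖ₑ ^ 2 + 2 * (ENNReal.ofReal (4 / (L * K)) * Z) := by
    intro t ht
    have h1 : ‖G t‖ₑ ≤ ‖P t‖ₑ + ‖G t - P t‖ₑ := by
      have := enorm_add_le (P t) (G t - P t)
      rwa [add_sub_cancel] at this
    have h2 : ∀ a b : ℝ≥0∞, (a + b) ^ 2 ≤ 2 * a ^ 2 + 2 * b ^ 2 := by
      intro a b
      have := ENNReal.rpow_add_le_mul_rpow_add_rpow a b (p := 2) (by norm_num)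
      norm_num at this
      rw [← mul_add]
      exact_mod_cast this
    calc ‖G t‖ₑ ^ 2 ≤ (‖P t‖ₑ + ‖G t - P t‖ₑ) ^ 2 := by gcongr
      _ ≤ 2 * ‖P t‖ₑ ^ 2 + 2 * ‖G t - P t‖ₑ ^ 2 := h2 _ _
      _ ≤ _ := by gcongr; exact htail t ht
  have hPc : Continuous P := by
    refine continuous_finsetSum _ fun m _ => Continuous.mul ?_ continuous_const
    exact Complex.continuous_ofReal.comp (Real.continuous_sinc.comp (by fun_prop))
  have hPm : Measurable fun t => 2 * ‖P t‖ₑ ^ 2 :=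
    ((hPc.measurable.enorm).pow_const 2).const_mul 2
  refine (setLIntegral_mono' measurableSet_Icc hpt).trans ?_
  rw [lintegral_add_left hPm, setLIntegral_const, Real.volume_Icc]
  refine add_le_add ?_ ?_
  · rw [lintegral_const_mul _ ((hPc.measurable.enorm).pow_const 2)]
    refine mul_le_mul_right ((setLIntegral_le_lintegral _ _).trans ?_) _
    rw [hP, lintegral_sinc_sum_sq]
  · apply le_of_eq
    rw [← ENNReal.ofReal_ofNat 2, ← mul_assoc, ← ENNReal.ofReal_mul (by norm_num), mul_right_comm,
      ← ENNReal.ofReal_mul (by positivity)]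
    congr 2
    field_simp
    ring

end FourierSampling

/-! ### From one variable to the cube, rounding one coordinate at a time. -/

namespace FourierSampling

/-- The integer nearest to a real number, rounding half-integers up. -/
def nearestInt (t : ℝ) : ℤ := ⌊t + 1 / 2⌋

theorem measurable_nearestInt : Measurable nearestInt :=
  Int.measurable_floor.comp (measurable_id.add_const _)

theorem nearestInt_eq_iff {t : ℝ} {m : ℤ} :
    nearestInt t = m ↔ t ∈ Set.Ico ((m : ℝ) - 1 / 2) (m + 1 / 2) := by
  rw [nearestInt, Int.floor_eq_iff, Set.mem_Ico]
  constructor <;> rintro ⟨h1, h2⟩ <;> constructor <;> linarith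

theorem abs_nearestInt_sub_le (t : ℝ) : |(nearestInt t : ℝ) - t| ≤ 1 / 2 := by
  obtain ⟨h1, h2⟩ := nearestInt_eq_iff.1 (rfl : nearestInt t = nearestInt t)
  rw [abs_le]
  constructor <;> linarith

theorem abs_nearestInt_sub_le_abs_sub (t : ℝ) (m : ℤ) :
    |(nearestInt t : ℝ) - t| ≤ |(m : ℝ) - t| := by
  by_cases h : m = nearestInt t
  · rw [h]
  have h1 := abs_nearestInt_sub_le t
  have h2 : (1 : ℝ) ≤ |(m : ℝ) - nearestInt t| := by
    rw [← Int.cast_sub, ← Int.cast_abs]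
    exact_mod_cast Int.one_le_abs (sub_ne_zero.2 h)
  have h3 : |(m : ℝ) - nearestInt t| ≤ |(m : ℝ) - t| + |(nearestInt t : ℝ) - t| := by
    rw [abs_sub_comm (nearestInt t : ℝ) t]
    exact abs_sub_le _ _ _
  linarith

theorem setLIntegral_nearestInt (g : ℤ → ℝ≥0∞) (m : ℤ) :
    ∫⁻ t in {t : ℝ | nearestInt t = m}, g (nearestInt t) = g m := by
  have e : {t : ℝ | nearestInt t = m} = Set.Ico ((m : ℝ) - 1 / 2) (m + 1 / 2) :=
    Set.ext fun _ => nearestInt_eq_iff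
  have hms : MeasurableSet {t : ℝ | nearestInt t = m} := by rw [e]; exact measurableSet_Ico
  rw [setLIntegral_congr_fun (g := fun _ => g m) hms fun t (ht : nearestInt t = m) => by
    simp only [ht], setLIntegral_const, e, Real.volume_Ico]
  norm_num

theorem measurableSet_nearestInt_eq (m : ℤ) : MeasurableSet {t : ℝ | nearestInt t = m} :=
  measurable_nearestInt (measurableSet_singleton m)

/-- A sum over `ℤ` is written as the integral of a step function. Sampled and unsampled coordinates
are then both Lebesgue integrals, and Fubini treats them alike. -/
theorem lintegral_nearestInt (g : ℤ → ℝ≥0∞) :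
    ∫⁻ t : ℝ, g (nearestInt t) = ∑' m, g m := by
  have hU : (⋃ m : ℤ, {t : ℝ | nearestInt t = m}) = Set.univ := by
    ext t; simp
  rw [← setLIntegral_univ, ← hU, lintegral_iUnion measurableSet_nearestInt_eq]
  · simp only [setLIntegral_nearestInt]
  · intro m n hmn
    exact Set.disjoint_left.2 fun t (h1 : _ = m) (h2 : _ = n) => hmn (h1.symm.trans h2)

theorem sum_le_setLIntegral_nearestInt (g : ℤ → ℝ≥0∞) (S : Finset ℤ) {x : ℝ}
    (hS : ∀ m ∈ S, |(m : ℝ)| ≤ x) :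
    ∑ m ∈ S, g m ≤ ∫⁻ t in Set.Icc (-(x + 1)) (x + 1), g (nearestInt t) := by
  calc ∑ m ∈ S, g m = ∑ m ∈ S, ∫⁻ t in {t : ℝ | nearestInt t = m}, g (nearestInt t) := by
        simp only [setLIntegral_nearestInt]
    _ = ∫⁻ t in ⋃ m ∈ S, {t : ℝ | nearestInt t = m}, g (nearestInt t) := by
        rw [lintegral_biUnion_finset _ fun m _ => measurableSet_nearestInt_eq m]
        intro m _ n _ hmn
        exact Set.disjoint_left.2 fun t (h1 : _ = m) (h2 : _ = n) => hmn (h1.symm.trans h2)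
    _ ≤ _ := by
        refine lintegral_mono_set (Set.iUnion₂_subset fun m hm t (ht : _ = m) => ?_)
        have h1 := abs_nearestInt_sub_le t
        rw [ht] at h1
        have h2 := hS m hm
        obtain ⟨h3, h4⟩ := abs_le.1 h1
        obtain ⟨h5, h6⟩ := abs_le.1 h2
        exact ⟨by linarith, by linarith⟩

/-- Cauchy–Schwarz for lower integrals. -/
theorem lintegral_mul_sq_le_mul {α : Type*} [MeasurableSpace α] {μ : Measure α} {a b : α → ℝ≥0∞}
    (ha : AEMeasurable a μ) (hb : AEMeasurable b μ) :
    (∫⁻ x, a x * b x ∂μ) ^ 2 ≤ (∫⁻ x, a x ^ 2 ∂μ) * ∫⁻ x, b x ^ 2 ∂μ := by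
  have h := ENNReal.lintegral_mul_le_Lp_mul_Lq μ Real.HolderConjugate.two_two ha hb
  have h2 := pow_le_pow_left₀ zero_le h 2
  refine h2.trans (le_of_eq ?_)
  rw [mul_pow, ← ENNReal.rpow_natCast, ← ENNReal.rpow_natCast, ← ENNReal.rpow_mul,
    ← ENNReal.rpow_mul]
  norm_num

section Cube

variable {d : ℕ}

theorem measurableSet_unitCube (d : ℕ) : MeasurableSet (unitCube d) := by
  have : unitCube d = ⋂ i, (fun x : Space d => x i) ⁻¹' Set.Icc (-(1 / 2) : ℝ) (1 / 2) := by
    ext x; simp [unitCube]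
  rw [this]
  refine MeasurableSet.iInter fun i => ?_
  exact (by fun_prop : Measurable fun x : Space d => x i) measurableSet_Icc

/-- The other sides have length one and integrate out to one. -/
theorem setLIntegral_unitCube_coord (i : Fin d) {Φ : ℝ → ℝ≥0∞} (hΦ : Measurable Φ) :
    ∫⁻ x in unitCube d, Φ (x i) = ∫⁻ s in Set.Icc (-(1 / 2) : ℝ) (1 / 2), Φ s := by
  have : IsProbabilityMeasure
      ((volume : Measure ℝ).restrict (Set.Icc (-(1 / 2) : ℝ) (1 / 2))) :=
    ⟨by rw [Measure.restrict_apply_univ, Real.volume_Icc]; norm_num⟩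
  have h1 : MeasurePreserving (WithLp.ofLp : Space d → Fin d → ℝ)
      (volume.restrict (unitCube d))
      (Measure.pi fun _ : Fin d => (volume : Measure ℝ).restrict (Set.Icc (-(1 / 2) : ℝ) (1 / 2))) := by
    have h := (PiLp.volume_preserving_ofLp (Fin d)).restrict_preimage
      (s := Set.univ.pi fun _ : Fin d => Set.Icc (-(1 / 2) : ℝ) (1 / 2))
      (MeasurableSet.univ_pi fun _ => measurableSet_Icc)
    rw [volume_pi, Measure.restrict_pi_pi] at h
    have e : unitCube d = WithLp.ofLp ⁻¹'
        (Set.univ.pi fun _ : Fin d => Set.Icc (-(1 / 2) : ℝ) (1 / 2)) := by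
      ext x
      simp only [unitCube, Set.mem_preimage, Set.mem_univ_pi]
      rfl
    rw [e]
    exact h
  have h2 := (measurePreserving_eval (fun _ : Fin d =>
    (volume : Measure ℝ).restrict (Set.Icc (-(1 / 2) : ℝ) (1 / 2))) i).comp h1
  have := h2.lintegral_comp hΦ
  exact this

theorem toLp_update (y : Fin d → ℝ) (i : Fin d) (t : ℝ) :
    (WithLp.toLp 2 (Function.update y i t) : Space d)
      = WithLp.toLp 2 (Function.update y i 0) + EuclideanSpace.single i t := by
  ext j
  by_cases h : j = i
  · subst h; simp
  · simp [h]

/-- Along every coordinate line, the Fourier transform of a function supported on the unit cube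
is given by its cardinal series. -/
theorem hasSum_cardinal_fourier {f : Space d → ℂ} (hf : Integrable f)
    (hfD : ∀ᵐ x, x ∉ unitCube d → f x = 0) (hf2 : ∫⁻ x, ‖f x‖ₑ ^ 2 < ∞)
    (y : Fin d → ℝ) (i : Fin d) (t : ℝ) :
    HasSum (fun m : ℤ => (Real.sinc (Real.pi * (t - m)) : ℂ) *
      𝓕 f (WithLp.toLp 2 (Function.update y i (m : ℝ))))
      (𝓕 f (WithLp.toLp 2 (Function.update y i t))) := by
  set v : Space d := WithLp.toLp 2 (Function.update y i 0) with hv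
  -- The frozen coordinates of the frequency contribute a unimodular factor, absorbed into `a`; only
  -- the phase in `x i` varies along the line.
  set a : Space d → ℂ := fun x => Complex.exp ((-2 * Real.pi * inner ℝ x v : ℝ) * Complex.I) * f x
    with ha
  have hna : ∀ x, ‖a x‖ₑ = ‖f x‖ₑ := fun x => by
    rw [ha, enorm_mul, ← ofReal_norm, Complex.norm_exp_ofReal_mul_I]; simp
  have hai : Integrable a := by
    refine hf.bdd_mul (c := 1) ?_ (Filter.Eventually.of_forall fun x => ?_)
    · apply Continuous.aestronglyMeasurable
      fun_prop
    · rw [Complex.norm_exp_ofReal_mul_I]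
  have hF : ∀ s : ℝ, 𝓕 f (WithLp.toLp 2 (Function.update y i s))
      = ∫ x, a x * Complex.exp (-(2 * Real.pi * Complex.I * s * (x i : ℝ))) := by
    intro s
    rw [toLp_update, Real.fourier_eq']
    congr 1 with x
    rw [inner_add_right, EuclideanSpace.inner_single_right, smul_eq_mul]
    simp only [ha]
    rw [mul_right_comm (Complex.exp _) (f x) _, ← Complex.exp_add]
    congr 2
    simp only [conj_trivial]
    push_cast
    ring
  have hexpi : ∀ s : ℝ, Integrable
      (fun x : Space d => a x * Complex.exp (-(2 * Real.pi * Complex.I * s * (x i : ℝ)))) := by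
    intro s
    refine hai.mul_bdd (c := 1) ?_ (Filter.Eventually.of_forall fun x => ?_)
    · apply Continuous.aestronglyMeasurable
      fun_prop
    · rw [show -(2 * Real.pi * Complex.I * s * (x i : ℝ))
        = ((-(2 * Real.pi * s * x i) : ℝ) : ℂ) * Complex.I by push_cast; ring,
        Complex.norm_exp_ofReal_mul_I]
  set E : Finset ℤ → ℝ → ℂ := fun S x => Complex.exp (-(2 * Real.pi * Complex.I * t * x)) -
        ∑ m ∈ S, (Real.sinc (Real.pi * (t - m)) : ℂ) *
          Complex.exp (-(2 * Real.pi * Complex.I * m * x)) with hE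
  have hEc : ∀ S, Continuous (E S) := fun S => by rw [hE]; fun_prop
  set Z := ∫⁻ x, ‖f x‖ₑ ^ 2 with hZ
  -- The error is the integral of `a` against the error in approximating the exponential in `x i`.
  -- Cauchy–Schwarz on the cube separates the two, and the second factor tends to zero by
  -- `hasSum_sinc_sq`.
  have hbound : ∀ S : Finset ℤ, ‖∑ m ∈ S, (Real.sinc (Real.pi * (t - m)) : ℂ) *
      𝓕 f (WithLp.toLp 2 (Function.update y i (m : ℝ))) -
        𝓕 f (WithLp.toLp 2 (Function.update y i t))‖ₑ ^ 2 ≤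
      Z * ENNReal.ofReal (1 - ∑ m ∈ S, Real.sinc (Real.pi * (t - m)) ^ 2) := by
    intro S
    have h1 : ∑ m ∈ S, (Real.sinc (Real.pi * (t - m)) : ℂ) *
        𝓕 f (WithLp.toLp 2 (Function.update y i (m : ℝ))) -
          𝓕 f (WithLp.toLp 2 (Function.update y i t)) = - ∫ x, a x * E S (x i) := by
      simp only [hF, ← integral_const_mul]
      have him : ∀ m ∈ S, Integrable (fun x : Space d => (Real.sinc (Real.pi * (t - m)) : ℂ) *
          (a x * Complex.exp (-(2 * Real.pi * Complex.I * ((m : ℝ) : ℂ) * (x i : ℝ))))) :=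
        fun m _ => (hexpi m).const_mul _
      rw [← integral_finsetSum _ him, ← integral_sub (integrable_finsetSum _ him) (hexpi t),
        ← integral_neg]
      congr 1 with x
      rw [hE]
      simp only
      rw [mul_sub, Finset.mul_sum, neg_sub]
      congr 1
      refine Finset.sum_congr rfl fun m _ => ?_
      push_cast
      ring
    have h2 : ∫⁻ x, ‖a x * E S (x i)‖ₑ = ∫⁻ x in unitCube d, ‖f x‖ₑ * ‖E S (x i)‖ₑ := by
      rw [← lintegral_indicator (measurableSet_unitCube d)]
      apply lintegral_congr_ae
      filter_upwards [hfD] with x hx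
      rw [enorm_mul, hna]
      by_cases hxD : x ∈ unitCube d
      · rw [Set.indicator_of_mem hxD]
      · rw [Set.indicator_of_notMem hxD, hx hxD]; simp
    have hEm : Measurable fun s => ‖E S s‖ₑ ^ 2 := ((hEc S).measurable.enorm).pow_const 2
    rw [h1, enorm_neg]
    calc ‖∫ x, a x * E S (x i)‖ₑ ^ 2 ≤ (∫⁻ x, ‖a x * E S (x i)‖ₑ) ^ 2 := by
          gcongr; exact enorm_integral_le_lintegral_enorm _
      _ = (∫⁻ x in unitCube d, ‖f x‖ₑ * ‖E S (x i)‖ₑ) ^ 2 := by rw [h2]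
      _ ≤ (∫⁻ x in unitCube d, ‖f x‖ₑ ^ 2) * ∫⁻ x in unitCube d, ‖E S (x i)‖ₑ ^ 2 := by
          refine lintegral_mul_sq_le_mul hf.aestronglyMeasurable.enorm.restrict ?_
          exact ((hEc S).measurable.comp
            (by fun_prop : Measurable fun x : Space d => x i)).enorm.aemeasurable
      _ ≤ Z * ENNReal.ofReal (1 - ∑ m ∈ S, Real.sinc (Real.pi * (t - m)) ^ 2) := by
          rw [setLIntegral_unitCube_coord i hEm, hE, lintegral_exp_sub_sum_sq]
          exact mul_le_mul_left (setLIntegral_le_lintegral _ _) _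
  have hlim : Filter.Tendsto (fun S : Finset ℤ => Z * ENNReal.ofReal
      (1 - ∑ m ∈ S, Real.sinc (Real.pi * (t - m)) ^ 2)) Filter.atTop (nhds 0) := by
    have h1 : Filter.Tendsto (fun S : Finset ℤ =>
        1 - ∑ m ∈ S, Real.sinc (Real.pi * (t - m)) ^ 2) Filter.atTop (nhds (1 - 1)) :=
      Filter.Tendsto.const_sub 1 (hasSum_sinc_sq t)
    have h2 := ENNReal.Tendsto.const_mul (a := Z) (ENNReal.tendsto_ofReal h1) (Or.inr hf2.ne)
    simpa using h2
  have hsq := tendsto_of_tendsto_of_tendsto_of_le_of_le tendsto_const_nhds hlim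
    (fun _ => zero_le) hbound
  rw [HasSum]
  rw [tendsto_iff_norm_sub_tendsto_zero]
  have h3 := (ENNReal.tendsto_toReal ENNReal.zero_ne_top).comp hsq
  have h4 := (Real.continuous_sqrt.tendsto _).comp h3
  simp only [ENNReal.toReal_zero, Real.sqrt_zero] at h4
  refine h4.congr fun S => ?_
  simp only [Function.comp, ENNReal.toReal_pow, toReal_enorm]
  rw [Real.sqrt_sq (norm_nonneg _)]

/-- Round the coordinates in `s` to the nearest integers. -/
def roundOn (s : Finset (Fin d)) (y : Fin d → ℝ) : Fin d → ℝ :=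
  fun j => if j ∈ s then (nearestInt (y j) : ℝ) else y j

theorem measurable_roundOn (s : Finset (Fin d)) : Measurable (roundOn s) := by
  refine measurable_pi_lambda _ fun j => ?_
  unfold roundOn
  split_ifs
  · exact (measurable_from_top (f := fun m : ℤ => (m : ℝ))).comp
      (measurable_nearestInt.comp (measurable_pi_apply j))
  · exact measurable_pi_apply j

theorem roundOn_update_of_notMem {s : Finset (Fin d)} {i : Fin d} (hi : i ∉ s) (y : Fin d → ℝ)
    (t : ℝ) : roundOn s (Function.update y i t) = Function.update (roundOn s y) i t := by
  ext j
  by_cases h : j = i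
  · subst h; simp [roundOn, hi]
  · simp [roundOn, h]

theorem roundOn_insert_update {s : Finset (Fin d)} {i : Fin d} (y : Fin d → ℝ)
    (t : ℝ) : roundOn (insert i s) (Function.update y i t)
      = Function.update (roundOn s y) i (nearestInt t : ℝ) := by
  ext j
  by_cases h : j = i
  · subst h; simp [roundOn]
  · simp [roundOn, h]

theorem lintegral_le_of_forall_coord {f g : (Fin d → ℝ) → ℝ≥0∞} (hf : Measurable f)
    (hg : Measurable g) (i : Fin d)
    (h : ∀ y, ∫⁻ t : ℝ, f (Function.update y i t) ≤ ∫⁻ t : ℝ, g (Function.update y i t)) :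
    ∫⁻ y, f y ≤ ∫⁻ y, g y := by
  rw [volume_pi]
  refine lintegral_le_of_lmarginal_le {i} hf hg fun y => ?_
  rw [lmarginal_singleton, lmarginal_singleton]
  exact h y

section Rounding

variable {F : (Fin d → ℝ) → ℂ}

theorem measurable_roundOn_sq (hF : Continuous F) (s : Finset (Fin d)) :
    Measurable fun y => ‖F (roundOn s y)‖ₑ ^ 2 :=
  ((hF.measurable.comp (measurable_roundOn s)).enorm).pow_const 2

/-- Coordinates are rounded in turn. Along each line in the new coordinate, rounding replaces the
energy of a cardinal series by that of its samples, which is no smaller. -/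
theorem lintegral_roundOn_le_univ (hF : Continuous F)
    (hFs : ∀ y i t, HasSum (fun m : ℤ => (Real.sinc (Real.pi * (t - m)) : ℂ) *
      F (Function.update y i (m : ℝ))) (F (Function.update y i t))) (s : Finset (Fin d)) :
    ∫⁻ y, ‖F (roundOn s y)‖ₑ ^ 2 ≤ ∫⁻ y, ‖F (roundOn Finset.univ y)‖ₑ ^ 2 := by
  have key : ∀ u : Finset (Fin d), ∫⁻ y, ‖F (roundOn s y)‖ₑ ^ 2 ≤
      ∫⁻ y, ‖F (roundOn (u ∪ s) y)‖ₑ ^ 2 := by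
    intro u
    induction u using Finset.induction_on with
    | empty => simp
    | insert i u _ ih =>
      refine ih.trans ?_
      rw [Finset.insert_union]
      by_cases hi : i ∈ u ∪ s
      · rw [Finset.insert_eq_of_mem hi]
      refine lintegral_le_of_forall_coord (measurable_roundOn_sq hF _) (measurable_roundOn_sq hF _) i
        fun y => ?_
      simp only [roundOn_update_of_notMem hi, roundOn_insert_update]
      rw [lintegral_nearestInt fun m : ℤ => ‖F (Function.update (roundOn (u ∪ s) y) i (m : ℝ))‖ₑ ^ 2]
      exact lintegral_cardinal_sq_le (G := fun t => F (Function.update (roundOn (u ∪ s) y) i t))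
        (hFs _ i)
  have := key Finset.univ
  rwa [Finset.union_eq_left.2 (Finset.subset_univ s)] at this

/-- Box of half-width `b` in the coordinates of `s` and half-width `a` in the others. -/
def mixedBox (s : Finset (Fin d)) (a b : ℝ) : Set (Fin d → ℝ) :=
  {y | ∀ j, |y j| ≤ if j ∈ s then b else a}

theorem measurableSet_mixedBox (s : Finset (Fin d)) (a b : ℝ) :
    MeasurableSet (mixedBox s a b) := by
  have : mixedBox s a b = ⋂ j, {y | |y j| ≤ if j ∈ s then b else a} := by
    ext y; simp [mixedBox]
  rw [this]
  exact MeasurableSet.iInter fun j => measurableSet_le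
    ((measurable_pi_apply j).abs) measurable_const

/-- One step of the iteration: the windowed one-variable estimate along lines in direction `i`. The
window grows from `K` to `L * K + 1` in that coordinate only, the `+ 1` covering the unit cells of
the retained integers. -/
theorem setLIntegral_mixedBox_le (hF : Continuous F)
    (hFs : ∀ y i t, HasSum (fun m : ℤ => (Real.sinc (Real.pi * (t - m)) : ℂ) *
      F (Function.update y i (m : ℝ))) (F (Function.update y i t)))
    {K L : ℝ} (hK : 0 < K) (hL : 2 ≤ L) {s : Finset (Fin d)} {i : Fin d} (hi : i ∉ s) :
    ∫⁻ y in mixedBox s K (L * K + 1), ‖F (roundOn s y)‖ₑ ^ 2 ≤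
      2 * (∫⁻ y in mixedBox (insert i s) K (L * K + 1), ‖F (roundOn (insert i s) y)‖ₑ ^ 2) +
        ENNReal.ofReal (16 / L) * ∫⁻ y, ‖F (roundOn Finset.univ y)‖ₑ ^ 2 := by
  set b := L * K + 1 with hb
  have hm := measurable_roundOn_sq hF s
  have hm' := measurable_roundOn_sq hF (insert i s)
  have hB := measurableSet_mixedBox s K b
  have hB' := measurableSet_mixedBox (insert i s) K b
  refine le_trans ?_ (add_le_add_right (mul_le_mul_right
    (lintegral_roundOn_le_univ hF hFs (insert i s)) _) _)
  rw [← lintegral_indicator hB, ← lintegral_indicator hB', ← lintegral_const_mul _ (hm'.indicator hB'),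
    ← lintegral_const_mul _ hm', ← lintegral_add_left ((hm'.indicator hB').const_mul _)]
  refine lintegral_le_of_forall_coord (hm.indicator hB)
    (((hm'.indicator hB').const_mul _).add (hm'.const_mul _)) i fun y => ?_
  set G : ℝ → ℂ := fun t => F (Function.update (roundOn s y) i t) with hG
  have hGs := hFs (roundOn s y) i
  have hGc : Continuous G := hF.comp (by fun_prop)
  have hgm : Measurable fun t : ℝ => ‖G (nearestInt t : ℝ)‖ₑ ^ 2 :=
    ((hGc.measurable.comp ((measurable_from_top (f := fun m : ℤ => (m : ℝ))).comp
      measurable_nearestInt)).enorm).pow_const 2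
  have mem_iff : ∀ (u : Finset (Fin d)) (t : ℝ), Function.update y i t ∈ mixedBox u K b ↔
      |t| ≤ (if i ∈ u then b else K) ∧ ∀ j, j ≠ i → |y j| ≤ if j ∈ u then b else K := by
    intro u t
    exact Function.forall_update_iff (p := fun j z => |z| ≤ if j ∈ u then b else K) y
  -- The constraints on the other coordinates do not involve `t`, so a line either meets the box in
  -- the full window or misses it.
  by_cases hout : ∀ j, j ≠ i → |y j| ≤ if j ∈ s then b else K
  · have hout' : ∀ j, j ≠ i → |y j| ≤ if j ∈ insert i s then b else K := by
      intro j hj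
      simpa [hj] using hout j hj
    have e1 : ∀ t, (mixedBox s K b).indicator (fun y => ‖F (roundOn s y)‖ₑ ^ 2)
        (Function.update y i t) = (Set.Icc (-K) K).indicator (fun t => ‖G t‖ₑ ^ 2) t := by
      intro t
      have : Function.update y i t ∈ mixedBox s K b ↔ t ∈ Set.Icc (-K) K := by
        rw [mem_iff, if_neg hi, Set.mem_Icc, ← abs_le]
        exact ⟨fun h => h.1, fun h => ⟨h, hout⟩⟩
      by_cases ht : t ∈ Set.Icc (-K) K
      · rw [Set.indicator_of_mem ht, Set.indicator_of_mem (this.2 ht),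
          roundOn_update_of_notMem hi]
      · rw [Set.indicator_of_notMem ht, Set.indicator_of_notMem fun h => ht (this.1 h)]
    have e2 : ∀ t, (mixedBox (insert i s) K b).indicator
        (fun y => ‖F (roundOn (insert i s) y)‖ₑ ^ 2) (Function.update y i t)
        = (Set.Icc (-b) b).indicator (fun t => ‖G (nearestInt t : ℝ)‖ₑ ^ 2) t := by
      intro t
      have : Function.update y i t ∈ mixedBox (insert i s) K b ↔ t ∈ Set.Icc (-b) b := by
        rw [mem_iff, if_pos (Finset.mem_insert_self i s), Set.mem_Icc, ← abs_le]
        exact ⟨fun h => h.1, fun h => ⟨h, hout'⟩⟩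
      by_cases ht : t ∈ Set.Icc (-b) b
      · rw [Set.indicator_of_mem ht, Set.indicator_of_mem (this.2 ht), roundOn_insert_update]
      · rw [Set.indicator_of_notMem ht, Set.indicator_of_notMem fun h => ht (this.1 h)]
    simp only [e1, e2, roundOn_insert_update]
    change _ ≤ ∫⁻ t, (2 * (Set.Icc (-b) b).indicator (fun t => ‖G (nearestInt t : ℝ)‖ₑ ^ 2) t +
      ENNReal.ofReal (16 / L) * ‖G (nearestInt t : ℝ)‖ₑ ^ 2)
    rw [lintegral_indicator measurableSet_Icc,
      lintegral_add_left ((hgm.indicator measurableSet_Icc).const_mul _),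
      lintegral_const_mul _ (hgm.indicator measurableSet_Icc), lintegral_const_mul _ hgm,
      lintegral_indicator measurableSet_Icc, lintegral_nearestInt fun m : ℤ => ‖G (m : ℝ)‖ₑ ^ 2]
    refine (setLIntegral_cardinal_sq_le hGs hK hL (Finset.Icc (-⌊L * K⌋) ⌊L * K⌋) ?_).trans ?_
    · intro m hm
      obtain ⟨h1, h2⟩ := abs_le.1 hm
      rw [Finset.mem_Icc]
      refine ⟨?_, Int.le_floor.2 h2⟩
      rw [neg_le]
      exact Int.le_floor.2 (by push_cast; linarith)
    · refine add_le_add_left (mul_le_mul_right (sum_le_setLIntegral_nearestInt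
        (fun m : ℤ => ‖G (m : ℝ)‖ₑ ^ 2) _ fun m hm => ?_) _) _
      obtain ⟨h1, h2⟩ := Finset.mem_Icc.1 hm
      rw [abs_le]
      refine ⟨?_, Int.le_floor.1 h2⟩
      have := Int.le_floor.1 (neg_le.1 h1)
      push_cast at this
      linarith
  · have e1 : ∀ t, (mixedBox s K b).indicator (fun y => ‖F (roundOn s y)‖ₑ ^ 2)
        (Function.update y i t) = 0 := fun t =>
      Set.indicator_of_notMem (fun h => hout ((mem_iff s t).1 h).2) _
    simp [e1]

theorem setLIntegral_mixedBox_empty_le (hF : Continuous F)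
    (hFs : ∀ y i t, HasSum (fun m : ℤ => (Real.sinc (Real.pi * (t - m)) : ℂ) *
      F (Function.update y i (m : ℝ))) (F (Function.update y i t)))
    {K L : ℝ} (hK : 0 < K) (hL : 2 ≤ L) (s : Finset (Fin d)) :
    ∫⁻ y in mixedBox ∅ K (L * K + 1), ‖F (roundOn ∅ y)‖ₑ ^ 2 ≤
      2 ^ s.card * (∫⁻ y in mixedBox s K (L * K + 1), ‖F (roundOn s y)‖ₑ ^ 2) +
        2 ^ s.card * (ENNReal.ofReal (16 / L) * ∫⁻ y, ‖F (roundOn Finset.univ y)‖ₑ ^ 2) := by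
  induction s using Finset.induction_on with
  | empty => simp
  | insert i s hi ih =>
    refine ih.trans ?_
    rw [Finset.card_insert_of_notMem hi]
    set T := ENNReal.ofReal (16 / L) * ∫⁻ y, ‖F (roundOn Finset.univ y)‖ₑ ^ 2
    set X := ∫⁻ y in mixedBox (insert i s) K (L * K + 1), ‖F (roundOn (insert i s) y)‖ₑ ^ 2
    calc _ ≤ 2 ^ s.card * (2 * X + T) + 2 ^ s.card * T := by
          gcongr
          exact setLIntegral_mixedBox_le hF hFs hK hL hi
      _ = _ := by ring

end Rounding

end Cube

end FourierSampling

/-! ### The lower estimate for `ℤ^d` and the unit cube. -/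

namespace FourierSampling

variable {d : ℕ}

theorem norm_le_of_forall_abs_le {x : Space d} {c : ℝ} (h : ∀ j, |x j| ≤ c) :
    ‖x‖ ≤ d * c := by
  rcases Nat.eq_zero_or_pos d with rfl | hd
  · simp [Subsingleton.elim x 0]
  have hc : 0 ≤ c := (abs_nonneg _).trans (h ⟨0, hd⟩)
  rw [EuclideanSpace.norm_eq, Real.sqrt_le_iff]
  refine ⟨by positivity, ?_⟩
  have h1 : ∑ j, ‖x j‖ ^ 2 ≤ ∑ _j : Fin d, c ^ 2 := Finset.sum_le_sum fun j _ => by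
    rw [Real.norm_eq_abs]
    exact pow_le_pow_left₀ (abs_nonneg _) (h j) 2
  rw [Finset.sum_const, Finset.card_univ, Fintype.card_fin, nsmul_eq_mul] at h1
  have h2 : (1 : ℝ) ≤ d := by exact_mod_cast hd
  nlinarith [mul_nonneg (mul_nonneg (sub_nonneg.2 h2) (zero_le_one.trans h2)) (sq_nonneg c)]

/-- The ratios `x j / y j` can be moved onto the test vector `u`, which stays in the cube because
its coordinates only shrink. Consequently coordinatewise rounding finds a nearest lattice point in
the polar norm. -/
theorem gauge_polarSet_unitCube_mono (hD : IsCenteredSymmConvexBody (unitCube d)) {x y : Space d}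
    (h : ∀ j, |x j| ≤ |y j|) :
    gauge (polarSet (unitCube d)) x ≤ gauge (polarSet (unitCube d)) y := by
  refine gauge_polarSet_le (gauge_nonneg _) fun u hu => ?_
  set w : Space d := WithLp.toLp 2 fun j => u j * (x j / y j) with hw
  have hwD : w ∈ unitCube d := by
    intro j
    have h1 : |x j / y j| ≤ 1 := by
      rw [abs_div]
      exact div_le_one_of_le₀ (h j) (abs_nonneg _)
    rw [Set.mem_Icc, ← abs_le]
    have h2 : |u j| ≤ 1 / 2 := abs_le.2 (hu j)
    change |u j * (x j / y j)| ≤ 1 / 2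
    rw [abs_mul]
    nlinarith [abs_nonneg (u j)]
  have e : inner ℝ u x = inner ℝ w y := by
    simp only [PiLp.inner_apply, RCLike.inner_apply, conj_trivial]
    refine Finset.sum_congr rfl fun j _ => ?_
    change x j * u j = y j * (u j * (x j / y j))
    by_cases hy : y j = 0
    · have hx : x j = 0 := by simpa [hy] using h j
      simp [hx]
    · field_simp
  rw [e]
  exact inner_le_gauge_polarSet hD hwD

/-- The vector of nearest integers of the coordinates. -/
def nearestLatticePoint (y : Fin d → ℝ) : Fin d → ℤ := fun j => nearestInt (y j)

theorem measurable_nearestLatticePoint :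
    Measurable (nearestLatticePoint : (Fin d → ℝ) → Fin d → ℤ) :=
  measurable_pi_lambda _ fun j => measurable_nearestInt.comp (measurable_pi_apply j)

/-- The integer point of `Space d` with the given coordinates. -/
def latticePoint (n : Fin d → ℤ) : Space d := WithLp.toLp 2 fun j => (n j : ℝ)

theorem latticePoint_injective : Function.Injective (latticePoint : (Fin d → ℤ) → Space d) := by
  intro m n h
  funext j
  have : (latticePoint m) j = (latticePoint n) j := by rw [h]
  exact Int.cast_injective (α := ℝ) this

theorem toLp_roundOn_univ (y : Fin d → ℝ) :
    (WithLp.toLp 2 (roundOn Finset.univ y) : Space d) = latticePoint (nearestLatticePoint y) := by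
  ext j
  simp [roundOn, latticePoint, nearestLatticePoint]

/-- The half-open unit cube around a lattice point. -/
def latticeCell (n : Fin d → ℤ) : Set (Space d) :=
  WithLp.ofLp ⁻¹' (nearestLatticePoint ⁻¹' {n})

theorem measurableSet_latticeCell (n : Fin d → ℤ) : MeasurableSet (latticeCell n) :=
  (PiLp.volume_preserving_ofLp (Fin d)).measurable
    (measurable_nearestLatticePoint (measurableSet_singleton n))

theorem volume_latticeCell (n : Fin d → ℤ) :
    volume (latticeCell n) = volume (nearestLatticePoint ⁻¹' {n}) :=
  (PiLp.volume_preserving_ofLp (Fin d)).measure_preimage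
    (measurable_nearestLatticePoint (measurableSet_singleton n)).nullMeasurableSet

theorem nearestInt_of_mem_latticeCell {n : Fin d → ℤ} {z : Space d} (hz : z ∈ latticeCell n)
    (j : Fin d) : nearestInt (z j) = n j :=
  congrFun (show nearestLatticePoint z.ofLp = n from hz) j

theorem norm_latticePoint_sub_le {n : Fin d → ℤ} {z : Space d} (hz : z ∈ latticeCell n) :
    ‖latticePoint n - z‖ ≤ d * (1 / 2) := by
  refine norm_le_of_forall_abs_le fun j => ?_
  have := abs_nearestInt_sub_le (z j)
  rwa [nearestInt_of_mem_latticeCell hz] at this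

/-- Only this inclusion is needed, since the Voronoi weights enter the lower estimate as upper
bounds for cell volumes. -/
theorem latticeCell_subset_voronoiRegion (hD : IsCenteredSymmConvexBody (unitCube d))
    (n : Fin d → ℤ) :
    latticeCell n ⊆ voronoiRegion (polarSet (unitCube d)) (integerLattice d) (latticePoint n) := by
  intro z hz ν hν _
  refine gauge_polarSet_unitCube_mono hD fun j => ?_
  obtain ⟨m, hm⟩ := hν j
  have := abs_nearestInt_sub_le_abs_sub (z j) m
  rw [nearestInt_of_mem_latticeCell hz] at this
  change |(n j : ℝ) - z j| ≤ |ν j - z j|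
  rwa [hm]

theorem lintegral_roundOn_univ (G : Space d → ℝ≥0∞) (μ : Measure (Fin d → ℝ)) :
    ∫⁻ y, G (WithLp.toLp 2 (roundOn Finset.univ y)) ∂μ =
      ∑' n, G (latticePoint n) * μ (nearestLatticePoint ⁻¹' {n}) := by
  simp only [toLp_roundOn_univ]
  rw [← lintegral_map (f := fun n : Fin d → ℤ => G (latticePoint n)) (measurable_of_countable _)
    measurable_nearestLatticePoint, lintegral_countable']
  refine tsum_congr fun n => ?_
  rw [Measure.map_apply measurable_nearestLatticePoint (measurableSet_singleton n)]

theorem setLIntegral_roundOn_univ_le (hD : IsCenteredSymmConvexBody (unitCube d))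
    (G : Space d → ℝ≥0∞) {a b r : ℝ} (hr : d * (b + 1) ≤ r) :
    ∫⁻ y in mixedBox Finset.univ a b, G (WithLp.toLp 2 (roundOn Finset.univ y)) ≤
      ∑' ω : {ω : Space d // ω ∈ integerLattice d ∧ ‖ω‖ ≤ r},
        voronoiWeight (polarSet (unitCube d)) (integerLattice d) ω * G ω := by
  rw [lintegral_roundOn_univ]
  set S : Set (Space d) := {ω | ω ∈ integerLattice d ∧ ‖ω‖ ≤ r}
  set Φ : Space d → ℝ≥0∞ := fun ω =>
    voronoiWeight (polarSet (unitCube d)) (integerLattice d) ω * G ω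
  change _ ≤ ∑' ω : S, Φ ω
  rw [tsum_subtype S Φ]
  refine le_trans (ENNReal.tsum_le_tsum fun n => ?_)
    (ENNReal.tsum_comp_le_tsum_of_injective latticePoint_injective (S.indicator Φ))
  rw [Measure.restrict_apply (measurable_nearestLatticePoint (measurableSet_singleton n))]
  rcases (nearestLatticePoint ⁻¹' {n} ∩ mixedBox Finset.univ a b).eq_empty_or_nonempty with
    h | ⟨y, hy1, hy2⟩
  · rw [h]; simp
  have hn : latticePoint n ∈ S := by
    refine ⟨fun j => ⟨n j, rfl⟩, (norm_le_of_forall_abs_le fun j => ?_).trans hr⟩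
    have h1 : nearestInt (y j) = n j := congrFun hy1 j
    have h2 := abs_nearestInt_sub_le (y j)
    have h3 : |y j| ≤ b := by simpa using hy2 j
    change |(n j : ℝ)| ≤ b + 1
    rw [h1] at h2
    have h4 := abs_sub_abs_le_abs_sub (n j : ℝ) (y j)
    linarith
  rw [Set.indicator_of_mem hn, mul_comm]
  refine mul_le_mul_left ((measure_mono Set.inter_subset_left).trans ?_) _
  rw [← volume_latticeCell]
  exact measure_mono (latticeCell_subset_voronoiRegion hD n)

theorem exists_lowFrequency_le_of_unitCube (hD : IsCenteredSymmConvexBody (unitCube d)) :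
    ∃ C : ℝ, 0 < C ∧ ∀ η : ℝ, 0 < η → ∃ L : ℝ, 1 ≤ L ∧
      ∀ (K : ℝ) (f : Lp ℂ 2 (volume : Measure (Space d))), 1 ≤ K →
        (∀ᵐ x, x ∉ unitCube d → f x = 0) → ‖f‖ = 1 →
        ∫⁻ ξ in Metric.closedBall 0 K, ‖𝓕 (fun x => f x) ξ‖ₑ ^ 2 ≤
          ENNReal.ofReal C * (∑' ω : {ω : Space d // ω ∈ integerLattice d ∧ ‖ω‖ ≤ L * K},
            voronoiWeight (polarSet (unitCube d)) (integerLattice d) ω *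
              ‖𝓕 (fun x => f x) (ω : Space d)‖ₑ ^ 2) + ENNReal.ofReal η := by
  obtain ⟨R, hR, hRD⟩ := hD.exists_norm_le
  obtain ⟨CB, hCB, hbessel⟩ := exists_tsum_cells_le_lintegral d R (d * (1 / 2))
  refine ⟨2 ^ d, by positivity, fun η hη => ?_⟩
  -- The accumulated error is `2 ^ d * (16 / L)` times the total energy of the lattice samples,
  -- which Bessel's inequality bounds by `CB`; this `L` makes it at most `η`.
  set L : ℝ := max 2 (2 ^ d * 16 * CB / η) with hL
  have hL2 : 2 ≤ L := le_max_left _ _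
  have hLpos : 0 < L := by linarith
  have hLη : 2 ^ d * (16 / L * CB) ≤ η := by
    have h1 : 2 ^ d * 16 * CB / η ≤ L := le_max_right _ _
    rw [div_le_iff₀ hη] at h1
    rw [show (2 : ℝ) ^ d * (16 / L * CB) = 2 ^ d * 16 * CB / L by ring, div_le_iff₀ hLpos]
    linarith
  -- Passing from a box of half-width `L * K + 1`, enlarged by rounding, to a Euclidean ball costs a
  -- factor `d`. Using `d + 1` keeps the constant at least one when `d = 0`.
  refine ⟨(d + 1) * (L + 2), ?_, fun K f hK hfD hf1 => ?_⟩
  · have : (0 : ℝ) ≤ d := Nat.cast_nonneg d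
    nlinarith
  have hfR := ae_lt_norm_imp_eq_zero hRD hfD
  have hfi := Lp.integrable_of_ae_support hfR
  have hf2 : ∫⁻ x, ‖f x‖ₑ ^ 2 < ∞ := by
    rw [← Lp_enorm_sq_eq]
    exact ENNReal.pow_lt_top enorm_lt_top
  set F : (Fin d → ℝ) → ℂ := fun y => 𝓕 (fun x => f x) (WithLp.toLp 2 y) with hF
  have hFc : Continuous F := (continuous_fourier hfi).comp (PiLp.continuous_toLp 2 _)
  have hFs := hasSum_cardinal_fourier hfi hfD hf2
  have hbox := setLIntegral_mixedBox_empty_le hFc hFs (lt_of_lt_of_le one_pos hK) hL2 Finset.univ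
  rw [Finset.card_univ, Fintype.card_fin] at hbox
  have hlow : ∫⁻ ξ in Metric.closedBall 0 K, ‖𝓕 (fun x => f x) ξ‖ₑ ^ 2 ≤
      ∫⁻ y in mixedBox ∅ K (L * K + 1), ‖F (roundOn ∅ y)‖ₑ ^ 2 := by
    have e : ∀ y : Fin d → ℝ, roundOn ∅ y = y := fun y => by funext j; simp [roundOn]
    simp only [e]
    have hmp := (PiLp.volume_preserving_ofLp (Fin d)).restrict_preimage
      (measurableSet_mixedBox (d := d) ∅ K (L * K + 1))
    rw [← hmp.lintegral_comp ((hFc.measurable.enorm).pow_const 2)]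
    refine lintegral_mono_set fun ξ hξ j => ?_
    rw [if_neg (Finset.notMem_empty j)]
    exact (PiLp.norm_apply_le ξ j).trans (mem_closedBall_zero_iff.1 hξ)
  have htotal : ∫⁻ y, ‖F (roundOn Finset.univ y)‖ₑ ^ 2 ≤ ENNReal.ofReal CB := by
    rw [lintegral_roundOn_univ fun ξ => ‖𝓕 (fun x => f x) ξ‖ₑ ^ 2]
    have h := hbessel (fun x => f x) hfi hfR (Fin d → ℤ) latticePoint latticeCell
      measurableSet_latticeCell (fun m n hmn => Disjoint.aedisjoint ?_)
      fun n z hz => norm_latticePoint_sub_le hz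
    · rw [Lp.lintegral_fourier_sq_eq_one hfi hf1, mul_one] at h
      refine le_trans (le_of_eq (tsum_congr fun n => ?_)) h
      rw [volume_latticeCell, mul_comm]
    · exact Set.disjoint_left.2 fun z h1 h2 => hmn
        ((show nearestLatticePoint z.ofLp = m from h1).symm.trans h2)
  refine hlow.trans (hbox.trans (add_le_add ?_ ?_))
  · rw [ENNReal.ofReal_pow (by norm_num), ENNReal.ofReal_ofNat]
    refine mul_le_mul_right (setLIntegral_roundOn_univ_le hD
      (fun ξ => ‖𝓕 (fun x => f x) ξ‖ₑ ^ 2) ?_) _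
    have : (0 : ℝ) ≤ d := Nat.cast_nonneg d
    have h1 : L * K + 1 + 1 ≤ (L + 2) * K := by linarith
    have h2 : 0 ≤ (L + 2) * K := by positivity
    nlinarith
  · refine le_trans ?_ (ENNReal.ofReal_le_ofReal hLη)
    rw [ENNReal.ofReal_mul (by positivity), ENNReal.ofReal_mul (by positivity),
      ENNReal.ofReal_pow (by norm_num), ENNReal.ofReal_ofNat]
    gcongr

end FourierSampling

end

/-! ### Transfer of the stability barrier. -/

theorem corollary1p6 (d : ℕ) (D : Set (FourierSampling.Space d))
    (hD : FourierSampling.IsCenteredSymmConvexBody D)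
    (R : ℕ → Submodule ℂ (Lp ℂ 2 (volume : Measure (FourierSampling.Space d))))
    (hR : ∀ N : ℕ, 1 ≤ N → FourierSampling.IsSubspaceOfL2 D (R N))
    (α : ℝ) (Ω₀ : Set (FourierSampling.Space d))
    (hΩ₀_closed : IsClosed Ω₀) (hΩ₀_countable : Ω₀.Countable)
    (hα : FourierSampling.IsStabilityBarrier D R Ω₀ α)
    (hΩ₀ : FourierSampling.gap (FourierSampling.polarSet D) Ω₀ < 1 / 4 ∨
      (D = FourierSampling.unitCube d ∧ Ω₀ = FourierSampling.integerLattice d))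
    (Ω : Set (FourierSampling.Space d))
    (hΩ_closed : IsClosed Ω) (hΩ_countable : Ω.Countable)
    (hΩ_voronoi : FourierSampling.HasAlmostDisjointVoronoi (FourierSampling.polarSet D) Ω)
    (hΩ_gap : FourierSampling.gap (Metric.closedBall 0 1) Ω < ⊤) :
    FourierSampling.IsStabilityBarrier D R Ω α := by
  intro c γ hc hγ hpos
  have hlow : ∃ C : ℝ, 0 < C ∧ ∀ η : ℝ, 0 < η → ∃ L : ℝ, 1 ≤ L ∧
      ∀ (K : ℝ) (f : Lp ℂ 2 (volume : Measure (FourierSampling.Space d))), 1 ≤ K →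
        (∀ᵐ x, x ∉ D → f x = 0) → ‖f‖ = 1 →
        ∫⁻ ξ in Metric.closedBall 0 K, ‖𝓕 (fun x => f x) ξ‖ₑ ^ 2 ≤
          ENNReal.ofReal C * (∑' ω : {ω : FourierSampling.Space d // ω ∈ Ω₀ ∧ ‖ω‖ ≤ L * K},
            FourierSampling.voronoiWeight (FourierSampling.polarSet D) Ω₀ ω *
              ‖𝓕 (fun x => f x) (ω : FourierSampling.Space d)‖ₑ ^ 2) + ENNReal.ofReal η := by
    rcases hΩ₀ with h | ⟨rfl, rfl⟩
    · exact FourierSampling.exists_lowFrequency_le_of_gap_lt hD hΩ₀_closed hΩ₀_countable h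
    · exact FourierSampling.exists_lowFrequency_le_of_unitCube hD
  obtain ⟨C₁, hC₁, h₁⟩ := FourierSampling.exists_sampling_le hD hΩ_countable hΩ_voronoi hΩ_gap
  obtain ⟨C₂, hC₂, h₂⟩ := hlow
  obtain ⟨v, hv, hvle⟩ : ∃ v : ℝ, 0 < v ∧ ENNReal.ofReal v ≤
      ⨅ N : ℕ, ⨅ _ : 1 ≤ N, FourierSampling.concentration D (R N) Ω (c * (N : ℝ) ^ γ) := by
    obtain ⟨r, hr0, hr⟩ := ENNReal.lt_iff_exists_nnreal_btwn.1 hpos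
    exact ⟨r, by exact_mod_cast hr0, by rw [ENNReal.ofReal_coe_nnreal]; exact hr.le⟩
  -- The error is half of the lower bound `v`, so the other half passes to the low-frequency energy.
  -- The same halving is used with `w` below.
  obtain ⟨M, hM, hM'⟩ := h₁ (v / 2) (by positivity)
  set w : ℝ := v / 2 / C₁ with hw
  have hwpos : 0 < w := by positivity
  obtain ⟨L, hL, hL'⟩ := h₂ (w / 2) (by positivity)
  set u : ℝ := w / 2 / C₂ with hu
  have hupos : 0 < u := by positivity
  have sub_bound : ∀ {a C : ℝ} {X : ℝ≥0∞}, 0 < a → 0 < C →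
      ENNReal.ofReal a ≤ ENNReal.ofReal C * X + ENNReal.ofReal (a / 2) →
      ENNReal.ofReal (a / 2 / C) ≤ X := by
    intro a C X ha hC h
    rw [← add_halves a, ENNReal.ofReal_add (by positivity) (by positivity), add_halves,
      ENNReal.add_le_add_iff_right ENNReal.ofReal_ne_top] at h
    rw [ENNReal.ofReal_div_of_pos hC]
    exact ENNReal.div_le_of_le_mul' h
  -- Since `N ^ γ ≥ 1`, the radius `c * N ^ γ + M` is at most `(c + M + 1) * N ^ γ`, and the `+ 1`
  -- makes the latter at least one, as the lower estimate requires. Only the constant changes, not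
  -- `γ`.
  refine hα (L * (c + M + 1)) γ (by positivity) hγ
    (lt_of_lt_of_le (ENNReal.ofReal_pos.2 hupos) ?_)
  refine le_iInf₂ fun N hN => le_iInf₂ fun f hf => le_iInf fun hf1 => ?_
  have hNγ : (1 : ℝ) ≤ (N : ℝ) ^ γ := Real.one_le_rpow (by exact_mod_cast hN) hγ.le
  have hfD := hR N hN f hf
  have hK1 : 1 ≤ (c + M + 1) * (N : ℝ) ^ γ := by nlinarith
  have hKM : c * (N : ℝ) ^ γ + M ≤ (c + M + 1) * (N : ℝ) ^ γ := by nlinarith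
  have s1 : ENNReal.ofReal v ≤ _ :=
    (hvle.trans ((iInf₂_le N hN).trans ((iInf₂_le f hf).trans (iInf_le _ hf1)))).trans
      (hM' (c * (N : ℝ) ^ γ) f hfD hf1)
  have s2 := (sub_bound hv hC₁ s1).trans (lintegral_mono_set (Metric.closedBall_subset_closedBall hKM))
  have s3 := sub_bound hwpos hC₂ (s2.trans (hL' _ f hK1 hfD hf1))
  rw [mul_assoc]
  exact s3
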